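/- Throughout, $G$ is a second countable étale groupoid (a locally compact Hausdorff topological groupoid whose range map $r:G\to G^{(0)}$ is a local homeomorphism) with source map $s$, whose unit space $G^{(0)}\subset G$ is compact and totally disconnected. Assume that $G$ is essentially principal, i.e. the interior of $\{g\in G: r(g)=s(g)\}$ is $G^{(0)}$. Definitions. - A $G$-set is a subset $U\subset G$ on which $r$ and $s$ are injective; if $U$ is open, $\tau_U=r\circ(s|_U)^{-1}:s(U)\to r(U)$. The topological full group $[[G]]$ is the group of all $\gamma\in\operatorname{Homeo}(G^{(0)})$ of the form $\gamma=\tau_U$ for a compact open $G$-set $U$; as $G$ is essentially principal, $U$ is determined by $\gamma$. - For an étale map $\pi:X\to Y$ and $f\in C_c(X,\mathbb Z)$ (continuous, compactly supported) put $\pi_*(f)(y)=\sum_{\pi(x)=y}f(x)$. Let $G^{(2)}=\{(g,h)\in G\times G: s(g)=r(h)\}$, and let $d_0(g,h)=h$, $d_1(g,h)=gh$, $d_2(g,h)=g$. Put $\delta_1=s_*-r_*:C_c(G,\mathbb Z)\to C_c(G^{(0)},\mathbb Z)$ and $\delta_2=d_{0*}-d_{1*}+d_{2*}:C_c(G^{(2)},\mathbb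 Z)\to C_c(G,\mathbb Z)$, and $H_1(G)=\ker\delta_1/\operatorname{Im}\delta_2$. The index map $I:[[G]]\to H_1(G)$ is the homomorphism $I(\tau_U)=[1_U]$. - An elementary subgroupoid of $G$ is a compact open subgroupoid $K\subset G$ with $K^{(0)}=G^{(0)}$ that is principal, i.e. every $g\in K$ with $r(g)=s(g)$ is a unit. $G$ is almost finite if for every compact $C\subset G$ and every $\varepsilon>0$ there is an elementary subgroupoid $K\subset G$ such that $|CKx\setminus Kx|<\varepsilon\,|K(x)|$ for all $x\in G^{(0)}$, where $Kx=\{k\in K: s(k)=x\}$, $CKx$ is the set of all products $ck$ with $c\in C$, $k\in Kx$, $s(c)=r(k)$, and $K(x)=r(Kx)$. - A homeomorphism $\gamma$ of $G^{(0)}$ is elementary if it has finite order and $\{x\in G^{(0)}:\gamma^k(x)=x\}$ is clopen for every $k\in\mathbb N$. Theorem. Let $G$ be as above and almost finite, and let $\gamma\in[[G]]$ satisfy $I(\gamma)=0$. Then there exist $\gamma_1,\gamma_2,\gamma_3,\gamma_4\in[[G]]$ such that $\gamma=\gamma_1\gamma_2\gamma_3\gamma_4$ and $\gamma_1,\gamma_2^2,\gamma_3,\gamma_4$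 are elementary. In particular, $\gamma$ is a product of four elements of $[[G]]$ of finite order. -/

import Mathlib

open scoped CompactlySupported Topology

namespace EtaleGpd

section Pushforward

variable {X Y Z : Type*} [TopologicalSpace X] [TopologicalSpace Y] [TopologicalSpace Z]

theorem finite_fiber_inter_support [T2Space Y] {p : X → Y} (hp : IsLocalHomeomorph p)
    (f : C_c(X, ℤ)) (y : Y) : (p ⁻¹' {y} ∩ Function.support f).Finite := by
  have hc : IsCompact (tsupport f ∩ p ⁻¹' {y}) :=
    f.hasCompactSupport.isCompact.inter_right (isClosed_singleton.preimage hp.continuous)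
  have hd : IsDiscrete (p ⁻¹' {y}) := by
    exact (hp.isLocalHomeomorphOn.mono (Set.subset_univ _)).isDiscrete_of_image
      ((Set.Subsingleton.isDiscrete (Set.subsingleton_singleton (a := y))).mono
        (Set.image_preimage_subset p {y}))
  exact (hc.finite (hd.mono Set.inter_subset_right)).subset
    fun x hx => ⟨subset_tsupport _ hx.2, hx.1⟩

/-- The function `y ↦ ∑_{p x = y} f x`; for `f` compactly supported and `p` étale each sum has
only finitely many nonzero terms. -/
noncomputable def fiberSum (p : X → Y) (f : X → ℤ) (y : Y) : ℤ :=
  ∑ᶠ x ∈ p ⁻¹' {y}, f x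

theorem fiberSum_eventuallyEq [T2Space X] [T2Space Y] {p : X → Y} (hp : IsLocalHomeomorph p)
    (f : C_c(X, ℤ)) (y₀ : Y) : ∀ᶠ y in 𝓝 y₀, fiberSum p f y = fiberSum p f y₀ := by
  classical
  have hfin := finite_fiber_inter_support hp f y₀
  obtain ⟨U, hU, hdisj⟩ := hfin.t2_separation
  choose e he hpe using hp
  have hp : IsLocalHomeomorph p := fun x => ⟨e x, he x, hpe x⟩
  have hinj : ∀ x, Set.InjOn p (e x).source := fun x => by
    rw [hpe x]; exact (e x).injOn
  set W : X → Set X := fun x => U x ∩ (e x).source ∩ f ⁻¹' {f x} with hW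
  have hWo : ∀ x, IsOpen (W x) := fun x =>
    ((hU x).2.inter (e x).open_source).inter ((isOpen_discrete {f x}).preimage f.continuous)
  have hxW : ∀ x, x ∈ W x := fun x => ⟨⟨(hU x).1, he x⟩, rfl⟩
  set Φ := p ⁻¹' {y₀} ∩ Function.support f with hΦ
  have hts : tsupport f = Function.support f :=
    (IsClosed.closure_eq (by
      have : Function.support f = f ⁻¹' {0}ᶜ := rfl
      rw [this]; exact (isClosed_discrete _).preimage f.continuous))
  have hK : IsCompact (tsupport f \ ⋃ x ∈ Φ, W x) :=
    f.hasCompactSupport.isCompact.diff (isOpen_biUnion fun x _ => hWo x)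
  have hcl : IsClosed (p '' (tsupport f \ ⋃ x ∈ Φ, W x)) :=
    (hK.image hp.continuous).isClosed
  have hy₀ : y₀ ∉ p '' (tsupport f \ ⋃ x ∈ Φ, W x) := by
    rintro ⟨x, ⟨hx, hx'⟩, rfl⟩
    exact hx' (Set.mem_biUnion (show x ∈ Φ from ⟨rfl, hts ▸ hx⟩) (hxW x))
  have h1 : ∀ᶠ y in 𝓝 y₀, ∀ x ∈ Φ, y ∈ p '' W x := by
    rw [Filter.eventually_all_finite hfin]
    intro x hx
    refine (hp.isOpenMap _ (hWo x)).mem_nhds ⟨x, hxW x, hx.1⟩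
  filter_upwards [h1, hcl.isOpen_compl.mem_nhds hy₀] with y hy hy'
  choose! g hgW hgy using hy
  have himg : p ⁻¹' {y} ∩ Function.support f = g '' Φ := by
    ext x
    constructor
    · rintro ⟨hx, hxf⟩
      by_contra hcon
      refine hy' ⟨x, ⟨hts ▸ hxf, fun hmem => hcon ?_⟩, hx⟩
      obtain ⟨z, hz, hxz⟩ := Set.mem_iUnion₂.1 hmem
      refine ⟨z, hz, ?_⟩
      exact hinj z (hgW z hz).1.2 hxz.1.2 ((hgy z hz).trans hx.symm)
    · rintro ⟨z, hz, rfl⟩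
      refine ⟨hgy z hz, ?_⟩
      have : f (g z) = f z := (hgW z hz).2
      rw [Function.mem_support, this]
      exact hz.2
  have hginj : Set.InjOn g Φ := by
    intro a ha b hb hab
    by_contra hne
    exact Set.disjoint_left.1 (hdisj ha hb hne) (hgW a ha).1.1 (hab ▸ (hgW b hb).1.1)
  unfold fiberSum
  rw [← finsum_mem_inter_support, himg, finsum_mem_image hginj,
    ← finsum_mem_inter_support f (p ⁻¹' {y₀})]
  exact finsum_mem_congr rfl fun x hx => (hgW x hx).2

/-- The homomorphism `p_* : C_c(X, ℤ) → C_c(Y, ℤ)`, `p_*(f)(y) = ∑_{p x = y} f x`, induced by an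
étale map `p : X → Y` of Hausdorff spaces. -/
noncomputable def pushforward [T2Space X] [T2Space Y] (p : X → Y) (hp : IsLocalHomeomorph p) :
    C_c(X, ℤ) →+ C_c(Y, ℤ) where
  toFun f :=
    { toFun := fiberSum p f
      continuous_toFun := continuous_iff_continuousAt.2 fun y₀ =>
        continuousAt_const.congr ((fiberSum_eventuallyEq hp f y₀).mono fun _ h => h.symm)
      hasCompactSupport' := by
        refine HasCompactSupport.intro (f.hasCompactSupport.isCompact.image hp.continuous) ?_
        intro y hy
        refine finsum_mem_eq_zero_of_forall_eq_zero fun x hx => ?_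
        by_contra hne
        exact hy ⟨x, subset_tsupport _ hne, hx⟩ }
  map_zero' := by
    ext y
    exact finsum_mem_eq_zero_of_forall_eq_zero fun x _ => rfl
  map_add' f g := by
    ext y
    exact finsum_mem_add_distrib' (finite_fiber_inter_support hp f y)
      (finite_fiber_inter_support hp g y)

theorem pushforward_apply [T2Space X] [T2Space Y] (p : X → Y) (hp : IsLocalHomeomorph p)
    (f : C_c(X, ℤ)) (y : Y) : pushforward p hp f y = ∑ᶠ x ∈ p ⁻¹' {y}, f x := rfl

theorem pushforward_comp [T2Space X] [T2Space Y] [T2Space Z] (p : X → Y) (q : Y → Z)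
    (hp : IsLocalHomeomorph p) (hq : IsLocalHomeomorph q) (f : C_c(X, ℤ)) :
    pushforward (q ∘ p) (hq.comp hp) f = pushforward q hq (pushforward p hp f) := by
  classical
  ext z
  simp only [pushforward_apply]
  have hfin := finite_fiber_inter_support (hq.comp hp) f z
  set S := (q ∘ p) ⁻¹' {z} ∩ Function.support f with hS
  have h1 : ∀ y ∈ q ⁻¹' {z}, ∑ᶠ x ∈ p ⁻¹' {y}, f x = ∑ᶠ x ∈ p ⁻¹' {y} ∩ S, f x := by
    intro y hy
    rw [← finsum_mem_inter_support]
    refine finsum_mem_congr (Set.ext fun x => ?_) fun _ _ => rfl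
    have hy : q y = z := hy
    simp only [hS, Set.mem_inter_iff, Set.mem_preimage, Set.mem_singleton_iff,
      Function.comp_apply]
    constructor
    · rintro ⟨rfl, h⟩; exact ⟨rfl, hy, h⟩
    · rintro ⟨h, -, h'⟩; exact ⟨h, h'⟩
  rw [finsum_mem_congr rfl h1, ← finsum_mem_inter_support f]
  have h2 : ∑ᶠ y ∈ q ⁻¹' {z}, ∑ᶠ x ∈ p ⁻¹' {y} ∩ S, f x
      = ∑ᶠ y ∈ p '' S, ∑ᶠ x ∈ p ⁻¹' {y} ∩ S, f x := by
    refine finsum_mem_inter_support_eq _ _ _ ?_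
    ext y
    simp only [Set.mem_inter_iff, Function.mem_support]
    refine ⟨fun ⟨_, h⟩ => ⟨?_, h⟩, fun ⟨hy, h⟩ => ⟨?_, h⟩⟩
    · obtain ⟨x, hx, -⟩ := exists_ne_zero_of_finsum_mem_ne_zero h
      exact ⟨x, hx.2, hx.1⟩
    · obtain ⟨x, hx, rfl⟩ := hy
      exact hx.1
  rw [h2, ← finsum_mem_biUnion]
  · refine finsum_mem_congr (Set.ext fun x => ⟨fun hx => Set.mem_biUnion ⟨x, hx, rfl⟩ ⟨rfl, hx⟩, fun hx => ?_⟩) fun _ _ => rfl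
    obtain ⟨y, -, hx⟩ := Set.mem_iUnion₂.1 hx
    exact hx.2
  · intro a _ b _ hab
    refine Set.disjoint_left.2 fun x hx hx' => hab ?_
    exact (hx.1 : p x = a).symm.trans hx'.1
  · exact hfin.image p
  · exact fun y _ => hfin.subset Set.inter_subset_right

end Pushforward

/-- The algebraic structure of a groupoid on the set `G` of its arrows, the units being regarded as
arrows. The product `mul g h` is meaningful only when `src g = rng h`; its values on other
pairs are arbitrary, and nothing below depends on them. -/
class GroupoidStr (G : Type*) where
  src : G → G
  rng : G → G
  inv : G → G
  mul : G → G → G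
  src_src : ∀ g, src (src g) = src g
  rng_src : ∀ g, rng (src g) = src g
  src_rng : ∀ g, src (rng g) = rng g
  rng_rng : ∀ g, rng (rng g) = rng g
  src_mul : ∀ g h, src g = rng h → src (mul g h) = src h
  rng_mul : ∀ g h, src g = rng h → rng (mul g h) = rng g
  mul_assoc : ∀ g h k, src g = rng h → src h = rng k → mul (mul g h) k = mul g (mul h k)
  rng_mul_self : ∀ g, mul (rng g) g = g
  mul_src_self : ∀ g, mul g (src g) = g
  src_inv : ∀ g, src (inv g) = rng g
  rng_inv : ∀ g, rng (inv g) = src g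
  mul_inv : ∀ g, mul g (inv g) = rng g
  inv_mul : ∀ g, mul (inv g) g = src g

open GroupoidStr

/-- The unit space `G⁽⁰⁾`, with the subspace topology when `G` is a topological space. -/
abbrev UnitSpace (G : Type*) [GroupoidStr G] : Type _ := {x : G // rng x = x}

/-- The space `G⁽²⁾` of composable pairs of arrows. -/
abbrev ComposablePairs (G : Type*) [GroupoidStr G] : Type _ :=
  {p : G × G // src p.1 = rng p.2}

section Maps

variable {G : Type*} [GroupoidStr G]

/-- The source map as a map onto the unit space. -/
def s (g : G) : UnitSpace G := ⟨src g, rng_src g⟩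

/-- The range map as a map onto the unit space. -/
def r (g : G) : UnitSpace G := ⟨rng g, rng_rng g⟩

/-- The face map `(g, h) ↦ h`. -/
def d₀ (p : ComposablePairs G) : G := p.1.2

/-- The face map `(g, h) ↦ gh`. -/
def d₁ (p : ComposablePairs G) : G := mul p.1.1 p.1.2

/-- The face map `(g, h) ↦ g`. -/
def d₂ (p : ComposablePairs G) : G := p.1.1

theorem s_eq_r_iff {g h : G} : s g = r h ↔ src g = rng h := Subtype.ext_iff

theorem s_eq_s_iff {g h : G} : s g = s h ↔ src g = src h := Subtype.ext_iff

theorem r_eq_r_iff {g h : G} : r g = r h ↔ rng g = rng h := Subtype.ext_iff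

theorem src_unit {x : G} (hx : rng x = x) : src x = x := by
  rw [← hx, src_rng]

theorem inv_mul_cancel_left {g h : G} (hgh : src g = rng h) : mul (inv g) (mul g h) = h := by
  rw [← mul_assoc _ _ _ (src_inv g) hgh, inv_mul, hgh, rng_mul_self]

theorem mul_inv_cancel_right {g h : G} (hgh : src g = rng h) : mul (mul g h) (inv h) = g := by
  rw [mul_assoc _ _ _ hgh (rng_inv h).symm, GroupoidStr.mul_inv, ← hgh, mul_src_self]

theorem inv_inv (g : G) : inv (inv g) = g := by
  have h := inv_mul_cancel_left (g := inv g) (h := g) (src_inv g)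
  rw [inv_mul] at h
  have h' := mul_src_self (inv (inv g))
  rwa [src_inv, rng_inv, h, eq_comm] at h'

/-- A `G`-set: a set of arrows on which the range and source maps are injective. -/
def IsGSet (U : Set G) : Prop := Set.InjOn (r : G → UnitSpace G) U ∧
  Set.InjOn (s : G → UnitSpace G) U

/-- The set of products `uv` with `u ∈ U`, `v ∈ V` composable. -/
def setMul (U V : Set G) : Set G :=
  {g | ∃ u ∈ U, ∃ v ∈ V, src u = rng v ∧ mul u v = g}

theorem setMul_eq_image (U V : Set G) :
    setMul U V = d₁ '' {p : ComposablePairs G | p.1.1 ∈ U ∧ p.1.2 ∈ V} := by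
  ext g
  constructor
  · rintro ⟨u, hu, v, hv, h, rfl⟩
    exact ⟨⟨(u, v), h⟩, ⟨hu, hv⟩, rfl⟩
  · rintro ⟨⟨⟨u, v⟩, h⟩, ⟨hu, hv⟩, rfl⟩
    exact ⟨u, hu, v, hv, h, rfl⟩

/-- The set `Kx` of arrows of `K` with source `x`. -/
def sourceFiber (K : Set G) (x : UnitSpace G) : Set G := {k ∈ K | s k = x}

/-- The `K`-orbit `K(x) = r(Kx)` of `x`. -/
def orbit (K : Set G) (x : UnitSpace G) : Set (UnitSpace G) := r '' sourceFiber K x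

theorem fiberSum_indicator {p : G → UnitSpace G} {U : Set G} (hinj : Set.InjOn p U)
    (hsurj : p '' U = Set.univ) (x : UnitSpace G) :
    ∑ᶠ g ∈ p ⁻¹' {x}, U.indicator (1 : G → ℤ) g = 1 := by
  obtain ⟨u, hu, rfl⟩ : x ∈ p '' U := hsurj ▸ Set.mem_univ x
  have h : p ⁻¹' {p u} ∩ Function.support (U.indicator (1 : G → ℤ)) = {u} := by
    ext g
    simp only [Set.mem_inter_iff, Set.mem_preimage, Set.mem_singleton_iff,
      Function.mem_support, ne_eq, Set.indicator_apply_eq_zero, Pi.one_apply, one_ne_zero,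
      imp_false, not_not]
    exact ⟨fun ⟨h1, h2⟩ => hinj h2 hu h1, fun h => by subst h; exact ⟨rfl, hu⟩⟩
  rw [← finsum_mem_inter_support, h, finsum_mem_singleton, Set.indicator_of_mem hu]
  rfl

end Maps

/-- An étale groupoid: a locally compact Hausdorff topological groupoid whose range map is a local
homeomorphism onto the unit space. -/
class EtaleGroupoid (G : Type*) [TopologicalSpace G] [GroupoidStr G] : Prop extends
    LocallyCompactSpace G, T2Space G where
  continuous_inv : Continuous (inv : G → G)
  continuous_mul : Continuous (d₁ : ComposablePairs G → G)
  isLocalHomeomorph_r : IsLocalHomeomorph (r : G → UnitSpace G)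

/-- `G` is essentially principal: the interior of the isotropy bundle is the unit space. -/
def IsEssentiallyPrincipal (G : Type*) [TopologicalSpace G] [GroupoidStr G] : Prop :=
  interior {g : G | rng g = src g} = {x : G | rng x = x}

/-! ### Almost finiteness and elementary homeomorphisms -/

/-- An elementary subgroupoid: a compact open principal subgroupoid containing all units. -/
structure IsElementarySubgroupoid {G : Type*} [TopologicalSpace G] [GroupoidStr G]
    (K : Set G) : Prop where
  isCompact : IsCompact K
  isOpen : IsOpen K
  units_mem : ∀ x : G, rng x = x → x ∈ K
  inv_mem : ∀ g ∈ K, inv g ∈ K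
  mul_mem : ∀ g ∈ K, ∀ h ∈ K, src g = rng h → mul g h ∈ K
  principal : ∀ g ∈ K, rng g = src g → rng g = g

/-- `G` is almost finite: for every compact `C ⊆ G` and `ε > 0` there is an elementary subgroupoid
`K` with `|CKx \ Kx| / |K(x)| < ε` for all units `x`. (The sets counted here are finite, `C`
and `K` being compact and the source map being étale, and `K(x)` contains `x`.) -/
def IsAlmostFinite (G : Type*) [TopologicalSpace G] [GroupoidStr G] : Prop :=
  ∀ C : Set G, IsCompact C → ∀ ε : ℝ, 0 < ε → ∃ K : Set G, IsElementarySubgroupoid K ∧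
    ∀ x : UnitSpace G,
      ((setMul C (sourceFiber K x) \ sourceFiber K x).ncard : ℝ) / ((orbit K x).ncard : ℝ) < ε

/-- A homeomorphism is elementary if it has finite order and, for every `k`, the set of fixed
points of its `k`-th power is clopen. -/
def IsElementaryHomeo {X : Type*} [TopologicalSpace X] (γ : X ≃ₜ X) : Prop :=
  IsOfFinOrder γ ∧ ∀ k : ℕ, IsClopen {x : X | (γ ^ k) x = x}

section Etale

variable {G : Type*} [TopologicalSpace G] [GroupoidStr G] [EtaleGroupoid G]

/-- Inversion as a homeomorphism. -/
def invHomeo (G : Type*) [TopologicalSpace G] [GroupoidStr G] [EtaleGroupoid G] : G ≃ₜ G where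
  toFun := inv
  invFun := inv
  left_inv := inv_inv
  right_inv := inv_inv
  continuous_toFun := EtaleGroupoid.continuous_inv
  continuous_invFun := EtaleGroupoid.continuous_inv

theorem isLocalHomeomorph_r : IsLocalHomeomorph (r : G → UnitSpace G) :=
  EtaleGroupoid.isLocalHomeomorph_r

theorem isLocalHomeomorph_s : IsLocalHomeomorph (s : G → UnitSpace G) := by
  have h : (s : G → UnitSpace G) = r ∘ invHomeo G :=
    funext fun g => Subtype.ext (rng_inv g).symm
  rw [h]
  exact isLocalHomeomorph_r.comp (invHomeo G).isLocalHomeomorph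

theorem continuous_rng : Continuous (rng : G → G) :=
  continuous_subtype_val.comp (isLocalHomeomorph_r (G := G)).continuous

theorem continuous_src : Continuous (src : G → G) :=
  continuous_subtype_val.comp (isLocalHomeomorph_s (G := G)).continuous

theorem isLocalHomeomorph_d₂ : IsLocalHomeomorph (d₂ : ComposablePairs G → G) := by
  refine IsLocalHomeomorph.mk _ fun p => ?_
  obtain ⟨e, he, hre⟩ := isLocalHomeomorph_r (G := G) p.1.2
  have hr : ∀ x ∈ e.target, r (e.symm x) = x := fun x hx => by rw [hre]; exact e.right_inv hx
  classical
  refine ⟨{ toFun := d₂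
            invFun := fun g => if h : s g ∈ e.target then
              ⟨(g, e.symm (s g)), s_eq_r_iff.1 (hr _ h).symm⟩ else p
            source := {q | q.1.2 ∈ e.source}
            target := {g | s g ∈ e.target}
            map_source' := ?_
            map_target' := ?_
            left_inv' := ?_
            right_inv' := ?_
            open_source := e.open_source.preimage (continuous_snd.comp continuous_subtype_val)
            open_target := e.open_target.preimage (isLocalHomeomorph_s (G := G)).continuous
            continuousOn_toFun := (continuous_fst.comp continuous_subtype_val).continuousOn
            continuousOn_invFun := ?_ }, he, fun _ _ => rfl⟩
  · intro q hq
    have : s q.1.1 = e q.1.2 := by rw [← hre]; exact s_eq_r_iff.2 q.2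
    change s q.1.1 ∈ e.target
    rw [this]; exact e.map_source hq
  · intro g hg
    have hg : s g ∈ e.target := hg
    simp only [dif_pos hg]
    exact e.map_target hg
  · intro q hq
    have h1 : s q.1.1 = e q.1.2 := by rw [← hre]; exact s_eq_r_iff.2 q.2
    have h2 : s (d₂ q) ∈ e.target := by
      change s q.1.1 ∈ e.target
      rw [h1]; exact e.map_source hq
    simp only [dif_pos h2]
    refine Subtype.ext (Prod.ext rfl ?_)
    change e.symm (s q.1.1) = q.1.2
    rw [h1]; exact e.left_inv hq
  · intro g hg
    have hg : s g ∈ e.target := hg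
    simp only [dif_pos hg]
    rfl
  · refine Topology.IsInducing.subtypeVal.continuousOn_iff.2 ?_
    have : ContinuousOn (fun g : G => (g, e.symm (s g))) {g | s g ∈ e.target} :=
      continuousOn_id.prodMk (e.continuousOn_symm.comp
        (isLocalHomeomorph_s (G := G)).continuous.continuousOn fun g hg => hg)
    refine this.congr fun g hg => ?_
    have hg : s g ∈ e.target := hg
    simp only [Function.comp_apply, dif_pos hg]

/-- The involution `(g, h) ↦ (gh, h⁻¹)` of the space of composable pairs. -/
def shearHomeo (G : Type*) [TopologicalSpace G] [GroupoidStr G] [EtaleGroupoid G] :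
    ComposablePairs G ≃ₜ ComposablePairs G where
  toFun p := ⟨(mul p.1.1 p.1.2, inv p.1.2), by
    simp only [src_mul _ _ p.2, rng_inv]⟩
  invFun p := ⟨(mul p.1.1 p.1.2, inv p.1.2), by
    simp only [src_mul _ _ p.2, rng_inv]⟩
  left_inv p := Subtype.ext (Prod.ext (mul_inv_cancel_right p.2) (inv_inv _))
  right_inv p := Subtype.ext (Prod.ext (mul_inv_cancel_right p.2) (inv_inv _))
  continuous_toFun := Continuous.subtype_mk (EtaleGroupoid.continuous_mul.prodMk
    (EtaleGroupoid.continuous_inv.comp (continuous_snd.comp continuous_subtype_val))) _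
  continuous_invFun := Continuous.subtype_mk (EtaleGroupoid.continuous_mul.prodMk
    (EtaleGroupoid.continuous_inv.comp (continuous_snd.comp continuous_subtype_val))) _

/-- The involution `(g, h) ↦ (h⁻¹, g⁻¹)` of the space of composable pairs. -/
def flipHomeo (G : Type*) [TopologicalSpace G] [GroupoidStr G] [EtaleGroupoid G] :
    ComposablePairs G ≃ₜ ComposablePairs G where
  toFun p := ⟨(inv p.1.2, inv p.1.1), by simp only [src_inv, rng_inv, p.2]⟩
  invFun p := ⟨(inv p.1.2, inv p.1.1), by simp only [src_inv, rng_inv, p.2]⟩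
  left_inv p := Subtype.ext (Prod.ext (inv_inv _) (inv_inv _))
  right_inv p := Subtype.ext (Prod.ext (inv_inv _) (inv_inv _))
  continuous_toFun := Continuous.subtype_mk
    ((EtaleGroupoid.continuous_inv.comp (continuous_snd.comp continuous_subtype_val)).prodMk
    (EtaleGroupoid.continuous_inv.comp (continuous_fst.comp continuous_subtype_val))) _
  continuous_invFun := Continuous.subtype_mk
    ((EtaleGroupoid.continuous_inv.comp (continuous_snd.comp continuous_subtype_val)).prodMk
    (EtaleGroupoid.continuous_inv.comp (continuous_fst.comp continuous_subtype_val))) _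

theorem isLocalHomeomorph_d₁ : IsLocalHomeomorph (d₁ : ComposablePairs G → G) :=
  isLocalHomeomorph_d₂.comp (shearHomeo G).isLocalHomeomorph

theorem isLocalHomeomorph_d₀ : IsLocalHomeomorph (d₀ : ComposablePairs G → G) := by
  have h : (d₀ : ComposablePairs G → G) = invHomeo G ∘ (d₂ ∘ flipHomeo G) :=
    funext fun p => (inv_inv _).symm
  rw [h]
  exact (invHomeo G).isLocalHomeomorph.comp
    (isLocalHomeomorph_d₂.comp (flipHomeo G).isLocalHomeomorph)

/-! ### Homology in degree one -/

/-- The boundary map `δ₁ = s_* - r_* : C_c(G, ℤ) → C_c(G⁽⁰⁾, ℤ)`. -/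
noncomputable def boundary₁ (G : Type*) [TopologicalSpace G] [GroupoidStr G] [EtaleGroupoid G] :
    C_c(G, ℤ) →+ C_c(UnitSpace G, ℤ) :=
  pushforward s isLocalHomeomorph_s - pushforward r isLocalHomeomorph_r

/-- The boundary map `δ₂ = d₀_* - d₁_* + d₂_* : C_c(G⁽²⁾, ℤ) → C_c(G, ℤ)`. -/
noncomputable def boundary₂ (G : Type*) [TopologicalSpace G] [GroupoidStr G] [EtaleGroupoid G] :
    C_c(ComposablePairs G, ℤ) →+ C_c(G, ℤ) :=
  pushforward d₀ isLocalHomeomorph_d₀ - pushforward d₁ isLocalHomeomorph_d₁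
    + pushforward d₂ isLocalHomeomorph_d₂

theorem boundary₁_boundary₂ (f : C_c(ComposablePairs G, ℤ)) :
    boundary₁ G (boundary₂ G f) = 0 := by
  have h1 : (s ∘ d₀ : ComposablePairs G → _) = s ∘ d₁ :=
    funext fun p => Subtype.ext (src_mul _ _ p.2).symm
  have h2 : (r ∘ d₂ : ComposablePairs G → _) = r ∘ d₁ :=
    funext fun p => Subtype.ext (rng_mul _ _ p.2).symm
  have h3 : (s ∘ d₂ : ComposablePairs G → _) = r ∘ d₀ := funext fun p => Subtype.ext p.2
  simp only [boundary₁, boundary₂, AddMonoidHom.sub_apply, AddMonoidHom.add_apply, map_add,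
    map_sub, ← pushforward_comp]
  simp only [h1, h2, h3]
  abel

/-- The first homology group `H₁(G) = ker δ₁ / im δ₂` with integer coefficients. -/
abbrev H₁ (G : Type*) [TopologicalSpace G] [GroupoidStr G] [EtaleGroupoid G] : Type _ :=
  (boundary₁ G).ker ⧸ (boundary₂ G).range.addSubgroupOf (boundary₁ G).ker

/-! ### The topological full group and the index map -/

/-- `U` is a compact open `G`-set with `s(U) = r(U) = G⁽⁰⁾` and `γ = τ_U`, where
`τ_U = r ∘ (s|U)⁻¹`. -/
structure IsTau (U : Set G) (γ : UnitSpace G ≃ₜ UnitSpace G) : Prop where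
  isCompact : IsCompact U
  isOpen : IsOpen U
  isGSet : IsGSet U
  image_s : s '' U = Set.univ
  image_r : r '' U = Set.univ
  apply_s : ∀ g ∈ U, γ (s g) = r g

theorem isOpen_units : IsOpen {x : G | rng x = x} := by
  rw [isOpen_iff_mem_nhds]
  intro x hx
  have hx : rng x = x := hx
  obtain ⟨e, he, hre⟩ := isLocalHomeomorph_r (G := G) x
  have h1 : e.source ∈ 𝓝 x := e.open_source.mem_nhds he
  have h2 : ∀ᶠ g in 𝓝 x, rng g ∈ e.source :=
    continuous_rng.continuousAt.eventually (by rw [hx]; exact h1)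
  filter_upwards [h1, h2] with g hg hg'
  refine e.injOn hg' hg ?_
  rw [← hre]
  exact Subtype.ext (rng_rng g)

theorem isClosed_composable : IsClosed {p : G × G | src p.1 = rng p.2} :=
  isClosed_eq (continuous_src.comp continuous_fst) (continuous_rng.comp continuous_snd)

theorem isOpen_setMul {U V : Set G} (hU : IsOpen U) (hV : IsOpen V) : IsOpen (setMul U V) := by
  rw [setMul_eq_image]
  exact isLocalHomeomorph_d₁.isOpenMap _ ((hU.prod hV).preimage continuous_subtype_val)

theorem isCompact_setMul {U V : Set G} (hU : IsCompact U) (hV : IsCompact V) :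
    IsCompact (setMul U V) := by
  rw [setMul_eq_image]
  refine IsCompact.image ?_ EtaleGroupoid.continuous_mul
  exact (isClosed_composable (G := G)).isClosedEmbedding_subtypeVal.isCompact_preimage
    (hU.prod hV)

theorem isTau_one [CompactSpace (UnitSpace G)] : IsTau {x : G | rng x = x} 1 where
  isCompact := isCompact_iff_compactSpace.2 ‹_›
  isOpen := isOpen_units
  isGSet := by
    refine ⟨fun x hx y hy h => ?_, fun x hx y hy h => ?_⟩
    · rw [r_eq_r_iff] at h
      exact (hx : rng x = x).symm.trans (h.trans hy)
    · rw [s_eq_s_iff, src_unit hx, src_unit hy] at h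
      exact h
  image_s := Set.eq_univ_of_forall fun x => ⟨x.1, x.2, Subtype.ext (src_unit x.2)⟩
  image_r := Set.eq_univ_of_forall fun x => ⟨x.1, x.2, Subtype.ext x.2⟩
  apply_s := fun x hx => Subtype.ext ((src_unit hx).trans (hx : rng x = x).symm)

theorem IsTau.inv {U : Set G} {γ : UnitSpace G ≃ₜ UnitSpace G} (h : IsTau U γ) :
    IsTau (GroupoidStr.inv ⁻¹' U) γ⁻¹ where
  isCompact := (invHomeo G).isClosedEmbedding.isCompact_preimage h.isCompact
  isOpen := h.isOpen.preimage EtaleGroupoid.continuous_inv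
  isGSet := by
    refine ⟨fun x hx y hy hxy => ?_, fun x hx y hy hxy => ?_⟩
    · refine (invHomeo G).injective (h.isGSet.2 hx hy ?_)
      exact s_eq_s_iff.2 ((src_inv x).trans ((r_eq_r_iff.1 hxy).trans (src_inv y).symm))
    · refine (invHomeo G).injective (h.isGSet.1 hx hy ?_)
      exact r_eq_r_iff.2 ((rng_inv x).trans ((s_eq_s_iff.1 hxy).trans (rng_inv y).symm))
  image_s := by
    refine Set.eq_univ_of_forall fun x => ?_
    obtain ⟨g, hg, rfl⟩ : x ∈ r '' U := h.image_r ▸ Set.mem_univ x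
    exact ⟨GroupoidStr.inv g, by simpa [inv_inv] using hg, Subtype.ext (src_inv g)⟩
  image_r := by
    refine Set.eq_univ_of_forall fun x => ?_
    obtain ⟨g, hg, rfl⟩ : x ∈ s '' U := h.image_s ▸ Set.mem_univ x
    exact ⟨GroupoidStr.inv g, by simpa [inv_inv] using hg, Subtype.ext (rng_inv g)⟩
  apply_s := by
    intro g hg
    have h1 := h.apply_s _ hg
    have h2 : s (GroupoidStr.inv g) = r g := Subtype.ext (src_inv g)
    have h3 : r (GroupoidStr.inv g) = s g := Subtype.ext (rng_inv g)
    rw [h2, h3] at h1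
    rw [← h1]
    exact γ.symm_apply_apply _

theorem IsTau.mul {U V : Set G} {γ γ' : UnitSpace G ≃ₜ UnitSpace G} (h : IsTau U γ)
    (h' : IsTau V γ') : IsTau (setMul U V) (γ * γ') where
  isCompact := isCompact_setMul h.isCompact h'.isCompact
  isOpen := isOpen_setMul h.isOpen h'.isOpen
  isGSet := by
    refine ⟨?_, ?_⟩
    · rintro _ ⟨u, hu, v, hv, huv, rfl⟩ _ ⟨u', hu', v', hv', huv', rfl⟩ he
      rw [r_eq_r_iff, rng_mul _ _ huv, rng_mul _ _ huv'] at he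
      obtain rfl := h.isGSet.1 hu hu' (r_eq_r_iff.2 he)
      obtain rfl := h'.isGSet.1 hv hv' (r_eq_r_iff.2 (huv.symm.trans huv'))
      rfl
    · rintro _ ⟨u, hu, v, hv, huv, rfl⟩ _ ⟨u', hu', v', hv', huv', rfl⟩ he
      rw [s_eq_s_iff, src_mul _ _ huv, src_mul _ _ huv'] at he
      obtain rfl := h'.isGSet.2 hv hv' (s_eq_s_iff.2 he)
      obtain rfl := h.isGSet.2 hu hu' (s_eq_s_iff.2 (huv.trans huv'.symm))
      rfl
  image_s := by
    refine Set.eq_univ_of_forall fun x => ?_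
    obtain ⟨v, hv, rfl⟩ : x ∈ s '' V := h'.image_s ▸ Set.mem_univ x
    obtain ⟨u, hu, huv⟩ : r v ∈ s '' U := h.image_s ▸ Set.mem_univ _
    rw [s_eq_r_iff] at huv
    exact ⟨_, ⟨u, hu, v, hv, huv, rfl⟩, Subtype.ext (src_mul _ _ huv)⟩
  image_r := by
    refine Set.eq_univ_of_forall fun x => ?_
    obtain ⟨u, hu, rfl⟩ : x ∈ r '' U := h.image_r ▸ Set.mem_univ x
    obtain ⟨v, hv, huv⟩ : s u ∈ r '' V := h'.image_r ▸ Set.mem_univ _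
    have huv := s_eq_r_iff.1 huv.symm
    exact ⟨_, ⟨u, hu, v, hv, huv, rfl⟩, Subtype.ext (rng_mul _ _ huv)⟩
  apply_s := by
    rintro _ ⟨u, hu, v, hv, huv, rfl⟩
    have h1 : s (GroupoidStr.mul u v) = s v := Subtype.ext (src_mul _ _ huv)
    have h2 : r (GroupoidStr.mul u v) = r u := Subtype.ext (rng_mul _ _ huv)
    rw [h1, h2]
    change γ (γ' (s v)) = r u
    rw [h'.apply_s v hv, ← s_eq_r_iff.2 huv, h.apply_s u hu]

/-- The topological full group `[[G]]` of an étale groupoid with compact unit space: all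
homeomorphisms of the unit space of the form `τ_U` for some compact open `G`-set `U`. -/
def topologicalFullGroup (G : Type*) [TopologicalSpace G] [GroupoidStr G] [EtaleGroupoid G]
    [CompactSpace (UnitSpace G)] : Subgroup (UnitSpace G ≃ₜ UnitSpace G) where
  carrier := {γ | ∃ U : Set G, IsTau U γ}
  one_mem' := ⟨_, isTau_one⟩
  mul_mem' := fun ⟨_, h⟩ ⟨_, h'⟩ => ⟨_, h.mul h'⟩
  inv_mem' := fun ⟨_, h⟩ => ⟨_, h.inv⟩

theorem IsTau.unique (hG : IsEssentiallyPrincipal G) {U V : Set G}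
    {γ : UnitSpace G ≃ₜ UnitSpace G} (hU : IsTau U γ) (hV : IsTau V γ) : U = V := by
  have key : ∀ {U V : Set G}, IsTau U γ → IsTau V γ → U ⊆ V := by
    intro U V hU hV u hu
    obtain ⟨v, hv, hvu⟩ : s u ∈ s '' V := hV.image_s ▸ Set.mem_univ _
    have hr : r v = r u := by rw [← hU.apply_s u hu, ← hV.apply_s v hv, hvu]
    have hopen : IsOpen (setMul (GroupoidStr.inv ⁻¹' V) U) :=
      isOpen_setMul (hV.isOpen.preimage EtaleGroupoid.continuous_inv) hU.isOpen
    have hsub : setMul (GroupoidStr.inv ⁻¹' V) U ⊆ {g : G | rng g = src g} := by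
      rintro _ ⟨w, hw, u', hu', h, rfl⟩
      change rng _ = src _
      rw [rng_mul _ _ h, src_mul _ _ h]
      have h1 := hV.apply_s _ hw
      have h2 := hU.apply_s _ hu'
      have h3 : r (GroupoidStr.inv w) = s w := Subtype.ext (rng_inv w)
      have h4 : s (GroupoidStr.inv w) = r w := Subtype.ext (src_inv w)
      rw [h3, h4, s_eq_r_iff.2 h, ← h2] at h1
      exact congrArg Subtype.val (γ.injective h1)
    have hc : src (GroupoidStr.inv v) = rng u := (src_inv v).trans (r_eq_r_iff.1 hr)
    have hmem : GroupoidStr.mul (GroupoidStr.inv v) u ∈ {x : G | rng x = x} := by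
      rw [← hG]
      exact interior_maximal hsub hopen
        ⟨_, by simpa [inv_inv] using hv, u, hu, hc, rfl⟩
    have h5 : GroupoidStr.mul (GroupoidStr.inv v) u = src v := by
      have h6 : rng _ = _ := hmem
      rw [rng_mul _ _ hc, rng_inv] at h6
      exact h6.symm
    have h7 := inv_mul_cancel_left hc
    rw [inv_inv, h5, mul_src_self] at h7
    exact h7 ▸ hv
  exact (key hU hV).antisymm (key hV hU)

/-- The characteristic function `1_U` of a compact open set, as an element of `C_c(G, ℤ)`. -/
noncomputable def charFn (U : Set G) (hc : IsCompact U) (ho : IsOpen U) : C_c(G, ℤ) where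
  toFun := U.indicator 1
  continuous_toFun := IsClopen.continuous_indicator ⟨hc.isClosed, ho⟩ continuous_const
  hasCompactSupport' := HasCompactSupport.intro hc fun _ hx => Set.indicator_of_notMem hx _

theorem IsTau.charFn_mem_ker {U : Set G} {γ : UnitSpace G ≃ₜ UnitSpace G} (h : IsTau U γ) :
    charFn U h.isCompact h.isOpen ∈ (boundary₁ G).ker := by
  rw [AddMonoidHom.mem_ker]
  ext x
  have h1 := fiberSum_indicator h.isGSet.2 h.image_s x
  have h2 := fiberSum_indicator h.isGSet.1 h.image_r x
  exact sub_eq_zero.2 (h1.trans h2.symm)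

/-- The class `[1_U]` in `H₁(G)`. -/
noncomputable def IsTau.toH₁ {U : Set G} {γ : UnitSpace G ≃ₜ UnitSpace G} (h : IsTau U γ) :
    H₁ G :=
  QuotientAddGroup.mk ⟨charFn U h.isCompact h.isOpen, h.charFn_mem_ker⟩

/-- The index map `I : [[G]] → H₁(G)`, `I(τ_U) = [1_U]`. When `G` is essentially principal the
compact open `G`-set `U` is unique, so that the choice is immaterial. -/
noncomputable def indexMap [CompactSpace (UnitSpace G)] (γ : topologicalFullGroup G) : H₁ G :=
  (Classical.choose_spec γ.2).toH₁

theorem indexMap_eq [CompactSpace (UnitSpace G)] (hG : IsEssentiallyPrincipal G)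
    (γ : topologicalFullGroup G) {U : Set G} (hU : IsTau U (γ : UnitSpace G ≃ₜ UnitSpace G)) :
    indexMap γ = hU.toH₁ := by
  have aux : ∀ {V : Set G} (hV : IsTau V (γ : UnitSpace G ≃ₜ UnitSpace G)), V = U →
      hV.toH₁ = hU.toH₁ := by
    rintro V hV rfl
    rfl
  exact aux (Classical.choose_spec γ.2) (IsTau.unique hG (Classical.choose_spec γ.2) hU)

end Etale

end EtaleGpd

/-!
Products of elementary homeomorphisms and the kernel of the index map of an almost finite groupoid.

Let `γ = τ_U` have index zero. For an elementary subgroupoid `K`, consider the double cosets `KgK`;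
each is finite, since `K` has finite orbits. If the arrows of `U` outside `K` could be matched with
each other so that matched arrows are inverse modulo `K`, then moving each arrow by `K` on the left
would turn `γ` into a homeomorphism `σ` which carries the source of an arrow to the source of the
matched one. The factor `γσ⁻¹` belongs to the full group of `K`, and so does `σ²`; the elements of
that full group are elementary (`IsElementarySubgroupoid.isElementaryHomeo`). Such a matching exists
as soon as `U` has as many arrows in `KgK` as in `Kg⁻¹K` for all `g ∉ K`: a maximal compact open
partial matching is then complete (`exists_matching`, `exists_factorization`). Note that `σ` itself
may fail to be an involution, because `Kg⁻¹K = KgK` is possible for `g ∉ K`.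

In general `U` is not symmetric in this sense. As `1_U` is a boundary `δ₂ f`, however, and a
composable pair `(g, h)` is a triangle with the edges `h`, `g`, `(gh)⁻¹`, the function `1_U` is, up
to functions invariant under inversion, a sum of edges of triangles with integer coefficients.
Reversing a triangle changes its sign, so that all coefficients may be taken equal to `-1`
(`exists_antisymm_add_sum_eq_zero`). A triangle with an edge in `K` is symmetric modulo `K`
(`sum_cosetCount_edge`) and can be discarded. If `K` is sufficiently invariant, then the remaining
triangles have few vertices in each orbit of `K`, and `K` moves all these vertices to distinct points
at which the arrow of `U` lies in `K` (`exists_isPlacement`). The edges of the moved triangles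
define a homeomorphism `τ` with `τ³ = 1` (`IsPlacement.exists_isTau`), and `γτ` is symmetric
modulo `K`, because its arrows outside `K` are, modulo `K`, those of `γ` and of `τ`. Thus
`γ = κ σ τ⁻¹` with `κ` in the full group of `K`; a fourth factor is not needed.
-/

set_option linter.unusedSectionVars false

/-! ### Compact open `G`-sets -/

namespace EtaleGpd

open GroupoidStr

/-- Injectivity neighbourhoods of an étale map to a totally disconnected compact space can be taken
compact and open. -/
theorem _root_.IsLocalHomeomorph.exists_isCompact_isOpen_injOn {Y X : Type*} [TopologicalSpace Y]
    [TopologicalSpace X] [CompactSpace X] [T2Space X] [TotallyDisconnectedSpace X] {p : Y → X}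
    (hp : IsLocalHomeomorph p) {O : Set Y} (hO : IsOpen O) {y : Y} (hy : y ∈ O) :
    ∃ V, IsCompact V ∧ IsOpen V ∧ Set.InjOn p V ∧ y ∈ V ∧ V ⊆ O := by
  obtain ⟨e, he, rfl⟩ := hp y
  have hN : IsOpen (e.source ∩ O) := e.open_source.inter hO
  have hN' : IsOpen (e '' (e.source ∩ O)) := hp.isOpenMap _ hN
  obtain ⟨V, hV, hyV, hVs⟩ := compact_exists_isClopen_in_isOpen hN'
    (Set.mem_image_of_mem e (⟨he, hy⟩ : y ∈ e.source ∩ O))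
  have hVt : V ⊆ e.target := by
    intro x hx
    obtain ⟨z, hz, rfl⟩ := hVs hx
    exact e.map_source hz.1
  have himg : e.symm '' V = e.source ∩ O ∩ e ⁻¹' V := by
    ext z
    constructor
    · rintro ⟨x, hx, rfl⟩
      obtain ⟨z, hz, rfl⟩ := hVs hx
      rw [e.left_inv hz.1]
      exact ⟨hz, hx⟩
    · rintro ⟨hz, hzV⟩
      exact ⟨e z, hzV, e.left_inv hz.1⟩
  refine ⟨e.symm '' V, hV.isClosed.isCompact.image_of_continuousOn
    (e.continuousOn_symm.mono hVt), ?_, ?_, ?_, ?_⟩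
  · rw [himg]
    exact hN.inter (hV.isOpen.preimage hp.continuous)
  · rw [himg]
    exact e.injOn.mono fun z hz => hz.1.1
  · exact ⟨e y, hyV, e.left_inv he⟩
  · rw [himg]
    exact fun z hz => hz.1.2

section Algebra

variable {G : Type*} [GroupoidStr G]

theorem s_mul {g h : G} (hgh : src g = rng h) : s (mul g h) = s h :=
  Subtype.ext (src_mul _ _ hgh)

theorem r_mul {g h : G} (hgh : src g = rng h) : r (mul g h) = r g :=
  Subtype.ext (rng_mul _ _ hgh)

theorem s_inv (g : G) : s (inv g) = r g := Subtype.ext (src_inv g)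

theorem r_inv (g : G) : r (inv g) = s g := Subtype.ext (rng_inv g)

theorem s_val (x : UnitSpace G) : s x.1 = x := Subtype.ext (src_unit x.2)

theorem r_val (x : UnitSpace G) : r x.1 = x := Subtype.ext x.2

theorem inv_mul_rev {g h : G} (hgh : src g = rng h) :
    inv (mul g h) = mul (inv h) (inv g) := by
  have h1 : src (inv h) = rng (inv g) := by rw [src_inv, rng_inv, hgh]
  have h2 : src (mul g h) = rng (inv h) := by rw [src_mul _ _ hgh, rng_inv]
  have h3 : mul (mul g h) (mul (inv h) (inv g)) = rng g := by
    rw [← GroupoidStr.mul_assoc _ _ _ h2 h1, mul_inv_cancel_right hgh, GroupoidStr.mul_inv]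
  have h4 : src (mul g h) = rng (mul (inv h) (inv g)) := by rw [h2, rng_mul _ _ h1]
  have h5 := inv_mul_cancel_left h4
  rw [h3] at h5
  rw [← h5]
  have h6 : rng g = src (inv (mul g h)) := by rw [src_inv, rng_mul _ _ hgh]
  rw [h6, mul_src_self]

theorem IsGSet.eq_of_s {U : Set G} (h : IsGSet U) {u v : G} (hu : u ∈ U) (hv : v ∈ U)
    (huv : s u = s v) : u = v := h.2 hu hv huv

theorem IsGSet.mono {U V : Set G} (h : IsGSet U) (hVU : V ⊆ U) : IsGSet V :=
  ⟨h.1.mono hVU, h.2.mono hVU⟩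

theorem IsGSet.setMul {U V : Set G} (h : IsGSet U) (h' : IsGSet V) : IsGSet (setMul U V) := by
  refine ⟨?_, ?_⟩
  · rintro _ ⟨u, hu, v, hv, huv, rfl⟩ _ ⟨u', hu', v', hv', huv', rfl⟩ he
    rw [r_mul huv, r_mul huv'] at he
    obtain rfl := h.1 hu hu' he
    obtain rfl := h'.1 hv hv' (r_eq_r_iff.2 (huv.symm.trans huv'))
    rfl
  · rintro _ ⟨u, hu, v, hv, huv, rfl⟩ _ ⟨u', hu', v', hv', huv', rfl⟩ he
    rw [s_mul huv, s_mul huv'] at he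
    obtain rfl := h'.2 hv hv' he
    obtain rfl := h.2 hu hu' (s_eq_s_iff.2 (huv.trans huv'.symm))
    rfl

theorem IsGSet.inv {U : Set G} (h : IsGSet U) : IsGSet (GroupoidStr.inv ⁻¹' U) := by
  refine ⟨fun x hx y hy hxy => ?_, fun x hx y hy hxy => ?_⟩
  · have := h.2 hx hy ((s_inv x).trans (hxy.trans (s_inv y).symm))
    rw [← inv_inv x, this, inv_inv]
  · have := h.1 hx hy ((r_inv x).trans (hxy.trans (r_inv y).symm))
    rw [← inv_inv x, this, inv_inv]

theorem image_s_setMul {U V : Set G} (h : r '' V ⊆ s '' U) : s '' setMul U V = s '' V := by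
  ext x
  constructor
  · rintro ⟨_, ⟨u, hu, v, hv, huv, rfl⟩, rfl⟩
    exact ⟨v, hv, (s_mul huv).symm⟩
  · rintro ⟨v, hv, rfl⟩
    obtain ⟨u, hu, huv⟩ := h ⟨v, hv, rfl⟩
    have huv := s_eq_r_iff.1 huv
    exact ⟨_, ⟨u, hu, v, hv, huv, rfl⟩, s_mul huv⟩

theorem image_r_setMul {U V : Set G} (h : s '' U ⊆ r '' V) : r '' setMul U V = r '' U := by
  ext x
  constructor
  · rintro ⟨_, ⟨u, hu, v, hv, huv, rfl⟩, rfl⟩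
    exact ⟨u, hu, (r_mul huv).symm⟩
  · rintro ⟨u, hu, rfl⟩
    obtain ⟨v, hv, huv⟩ := h ⟨u, hu, rfl⟩
    have huv := s_eq_r_iff.1 huv.symm
    exact ⟨_, ⟨u, hu, v, hv, huv, rfl⟩, r_mul huv⟩

theorem image_s_inv (U : Set G) : s '' (GroupoidStr.inv ⁻¹' U) = r '' U := by
  ext x
  constructor
  · rintro ⟨u, hu, rfl⟩
    exact ⟨_, hu, r_inv u⟩
  · rintro ⟨u, hu, rfl⟩
    exact ⟨GroupoidStr.inv u, by simpa [inv_inv] using hu, s_inv u⟩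

theorem image_r_inv (U : Set G) : r '' (GroupoidStr.inv ⁻¹' U) = s '' U := by
  ext x
  constructor
  · rintro ⟨u, hu, rfl⟩
    exact ⟨_, hu, s_inv u⟩
  · rintro ⟨u, hu, rfl⟩
    exact ⟨GroupoidStr.inv u, by simpa [inv_inv] using hu, r_inv u⟩

end Algebra

variable {G : Type*} [TopologicalSpace G] [GroupoidStr G]

/-- A compact open `G`-set. -/
structure IsBisection (U : Set G) : Prop where
  isCompact : IsCompact U
  isOpen : IsOpen U
  isGSet : IsGSet U

/-- The `G`-set `U` completed by the units outside `s(U)`. -/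
def extendByUnits (U : Set G) : Set G := U ∪ {g | rng g = g ∧ s g ∉ s '' U}

variable [EtaleGroupoid G]

theorem IsTau.isBisection {U : Set G} {γ : UnitSpace G ≃ₜ UnitSpace G} (h : IsTau U γ) :
    IsBisection U := ⟨h.isCompact, h.isOpen, h.isGSet⟩

theorem isOpen_image_s {U : Set G} (h : IsOpen U) : IsOpen (s '' U) :=
  isLocalHomeomorph_s.isOpenMap _ h

theorem isOpen_image_r {U : Set G} (h : IsOpen U) : IsOpen (r '' U) :=
  isLocalHomeomorph_r.isOpenMap _ h

theorem isClopen_image_s {U : Set G} (h : IsCompact U) (h' : IsOpen U) : IsClopen (s '' U) :=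
  ⟨(h.image isLocalHomeomorph_s.continuous).isClosed, isOpen_image_s h'⟩

theorem isClopen_image_r {U : Set G} (h : IsCompact U) (h' : IsOpen U) : IsClopen (r '' U) :=
  ⟨(h.image isLocalHomeomorph_r.continuous).isClosed, isOpen_image_r h'⟩

theorem isClopen_units : IsClopen {x : G | rng x = x} :=
  ⟨isClosed_eq continuous_rng continuous_id, isOpen_units⟩

namespace IsBisection

theorem isClopen {U : Set G} (h : IsBisection U) : IsClopen U := ⟨h.isCompact.isClosed, h.isOpen⟩

theorem inter {U V : Set G} (h : IsBisection U) (hV : IsClopen V) : IsBisection (U ∩ V) :=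
  ⟨h.isCompact.inter_right hV.isClosed, h.isOpen.inter hV.isOpen,
    h.isGSet.mono Set.inter_subset_left⟩

theorem diff {U V : Set G} (h : IsBisection U) (hV : IsClopen V) : IsBisection (U \ V) :=
  h.inter hV.compl

theorem setMul {U V : Set G} (h : IsBisection U) (h' : IsBisection V) :
    IsBisection (setMul U V) :=
  ⟨isCompact_setMul h.isCompact h'.isCompact, isOpen_setMul h.isOpen h'.isOpen,
    h.isGSet.setMul h'.isGSet⟩

theorem inv {U : Set G} (h : IsBisection U) : IsBisection (GroupoidStr.inv ⁻¹' U) :=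
  ⟨(invHomeo G).isClosedEmbedding.isCompact_preimage h.isCompact,
    h.isOpen.preimage EtaleGroupoid.continuous_inv, h.isGSet.inv⟩

theorem iUnion {ι : Type*} [Finite ι] {U : ι → Set G} (h : ∀ i, IsBisection (U i))
    (hs : Pairwise (Function.onFun Disjoint fun i => s '' U i))
    (hr : Pairwise (Function.onFun Disjoint fun i => r '' U i)) : IsBisection (⋃ i, U i) := by
  refine ⟨isCompact_iUnion fun i => (h i).isCompact, isOpen_iUnion fun i => (h i).isOpen, ?_, ?_⟩
  · rintro x hx y hy hxy
    obtain ⟨i, hi⟩ := Set.mem_iUnion.1 hx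
    obtain ⟨j, hj⟩ := Set.mem_iUnion.1 hy
    obtain rfl : i = j := by
      by_contra hne
      exact Set.disjoint_left.1 (hr hne) ⟨x, hi, rfl⟩ ⟨y, hj, hxy.symm⟩
    exact (h i).isGSet.1 hi hj hxy
  · rintro x hx y hy hxy
    obtain ⟨i, hi⟩ := Set.mem_iUnion.1 hx
    obtain ⟨j, hj⟩ := Set.mem_iUnion.1 hy
    obtain rfl : i = j := by
      by_contra hne
      exact Set.disjoint_left.1 (hs hne) ⟨x, hi, rfl⟩ ⟨y, hj, hxy.symm⟩
    exact (h i).isGSet.2 hi hj hxy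

theorem union {U V : Set G} (h : IsBisection U) (h' : IsBisection V)
    (hs : Disjoint (s '' U) (s '' V)) (hr : Disjoint (r '' U) (r '' V)) :
    IsBisection (U ∪ V) := by
  refine ⟨h.isCompact.union h'.isCompact, h.isOpen.union h'.isOpen, ?_, ?_⟩
  · rintro x (hx | hx) y (hy | hy) hxy
    · exact h.isGSet.1 hx hy hxy
    · exact (Set.disjoint_left.1 hr ⟨x, hx, rfl⟩ ⟨y, hy, hxy.symm⟩).elim
    · exact (Set.disjoint_left.1 hr ⟨y, hy, rfl⟩ ⟨x, hx, hxy⟩).elim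
    · exact h'.isGSet.1 hx hy hxy
  · rintro x (hx | hx) y (hy | hy) hxy
    · exact h.isGSet.2 hx hy hxy
    · exact (Set.disjoint_left.1 hs ⟨x, hx, rfl⟩ ⟨y, hy, hxy.symm⟩).elim
    · exact (Set.disjoint_left.1 hs ⟨y, hy, rfl⟩ ⟨x, hx, hxy⟩).elim
    · exact h'.isGSet.2 hx hy hxy

variable [CompactSpace (UnitSpace G)]

theorem exists_isTau {U : Set G} (h : IsBisection U) (hs : s '' U = Set.univ)
    (hr : r '' U = Set.univ) : ∃ γ : UnitSpace G ≃ₜ UnitSpace G, IsTau U γ := by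
  have : CompactSpace U := isCompact_iff_compactSpace.1 h.isCompact
  have bs : Function.Bijective (fun u : U => s u.1) :=
    ⟨fun u v huv => Subtype.ext (h.isGSet.2 u.2 v.2 huv), fun x => by
      obtain ⟨u, hu, rfl⟩ : x ∈ s '' U := hs ▸ Set.mem_univ x
      exact ⟨⟨u, hu⟩, rfl⟩⟩
  have br : Function.Bijective (fun u : U => r u.1) :=
    ⟨fun u v huv => Subtype.ext (h.isGSet.1 u.2 v.2 huv), fun x => by
      obtain ⟨u, hu, rfl⟩ : x ∈ r '' U := hr ▸ Set.mem_univ x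
      exact ⟨⟨u, hu⟩, rfl⟩⟩
  have cs : Continuous (Equiv.ofBijective _ bs) :=
    isLocalHomeomorph_s.continuous.comp continuous_subtype_val
  have cr : Continuous (Equiv.ofBijective _ br) :=
    isLocalHomeomorph_r.continuous.comp continuous_subtype_val
  refine ⟨cs.homeoOfEquivCompactToT2.symm.trans cr.homeoOfEquivCompactToT2,
    h.isCompact, h.isOpen, h.isGSet, hs, hr, fun g hg => ?_⟩
  have : cs.homeoOfEquivCompactToT2.symm (s g) = ⟨g, hg⟩ := by
    rw [Homeomorph.symm_apply_eq]
    rfl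
  rw [Homeomorph.trans_apply, this]
  rfl

theorem isTau_extendByUnits {U : Set G} (h : IsBisection U) (hsr : r '' U = s '' U) :
    ∃ γ : UnitSpace G ≃ₜ UnitSpace G, IsTau (extendByUnits U) γ := by
  have hu : IsBisection {g : G | rng g = g ∧ s g ∉ s '' U} :=
    (isTau_one (G := G)).isBisection.inter
      ((isClopen_image_s h.isCompact h.isOpen).compl.preimage isLocalHomeomorph_s.continuous)
  have hsu : s '' {g : G | rng g = g ∧ s g ∉ s '' U} = (s '' U)ᶜ := by
    ext x
    constructor
    · rintro ⟨g, hg, rfl⟩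
      exact hg.2
    · intro hx
      exact ⟨x.1, ⟨x.2, by rwa [s_val]⟩, s_val x⟩
  have hru : r '' {g : G | rng g = g ∧ s g ∉ s '' U} = (s '' U)ᶜ := by
    rw [← hsu]
    refine Set.image_congr fun g hg => Subtype.ext ?_
    exact hg.1.trans (src_unit hg.1).symm
  refine exists_isTau (h.union hu ?_ ?_) ?_ ?_
  · rw [hsu]; exact disjoint_compl_right
  · rw [hru, hsr]; exact disjoint_compl_right
  · rw [extendByUnits, Set.image_union, hsu, Set.union_compl_self]
  · rw [extendByUnits, Set.image_union, hru, hsr, Set.union_compl_self]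

end IsBisection

variable [CompactSpace (UnitSpace G)] [TotallyDisconnectedSpace (UnitSpace G)]

theorem exists_isBisection_mem {O : Set G} (hO : IsOpen O) {g : G} (hg : g ∈ O) :
    ∃ V, IsBisection V ∧ g ∈ V ∧ V ⊆ O := by
  obtain ⟨V, hVc, hVo, hVi, hgV, hVO⟩ := isLocalHomeomorph_s.exists_isCompact_isOpen_injOn hO hg
  obtain ⟨W, hWc, hWo, hWi, hgW, hWV⟩ :=
    isLocalHomeomorph_r.exists_isCompact_isOpen_injOn hVo hgV
  exact ⟨W, ⟨hWc, hWo, hWi, hVi.mono hWV⟩, hgW, hWV.trans hVO⟩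

theorem exists_finset_isBisection {R : Set G} (hc : IsCompact R) (ho : IsOpen R) :
    ∃ F : Finset (Set G), (∀ V ∈ F, IsBisection V) ∧ R = ⋃ V ∈ F, V := by
  classical
  have h : ∀ g ∈ R, ∃ V, IsBisection V ∧ g ∈ V ∧ V ⊆ R := fun g hg =>
    exists_isBisection_mem ho hg
  choose! V hV hgV hVR using h
  obtain ⟨t, htR, ht⟩ := hc.elim_nhds_subcover V fun g hg => (hV g hg).isOpen.mem_nhds (hgV g hg)
  refine ⟨t.image V, ?_, ?_⟩
  · intro W hW
    obtain ⟨g, hg, rfl⟩ := Finset.mem_image.1 hW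
    exact hV g (htR g hg)
  · rw [Finset.set_biUnion_finset_image]
    exact ht.antisymm (Set.iUnion₂_subset fun g hg => hVR g (htR g hg))

/-- A greedy choice along a finite cover of `R` by compact open `G`-sets yields a compact open
`G`-set in `R` to which no arrow of `R` can be added. -/
theorem exists_maximal_isBisection {R : Set G} (hc : IsCompact R) (ho : IsOpen R) :
    ∃ J ⊆ R, IsBisection J ∧ ∀ g ∈ R, s g ∈ s '' J ∨ r g ∈ r '' J := by
  classical
  obtain ⟨F, hF, rfl⟩ := exists_finset_isBisection hc ho
  clear hc ho
  induction F using Finset.induction_on with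
  | empty => exact ⟨∅, by simp, ⟨isCompact_empty, isOpen_empty, by simp [IsGSet]⟩, by simp⟩
  | insert V F _ ih =>
    obtain ⟨J, hJF, hJ, hmax⟩ := ih fun W hW => hF W (Finset.mem_insert_of_mem hW)
    have hV := hF V (Finset.mem_insert_self _ _)
    set N : Set G := V ∩ (s ⁻¹' (s '' J)ᶜ ∩ r ⁻¹' (r '' J)ᶜ) with hN
    have hNb : IsBisection N := hV.inter
      (((isClopen_image_s hJ.isCompact hJ.isOpen).compl.preimage
        isLocalHomeomorph_s.continuous).inter
      ((isClopen_image_r hJ.isCompact hJ.isOpen).compl.preimage isLocalHomeomorph_r.continuous))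
    refine ⟨J ∪ N, ?_, hJ.union hNb ?_ ?_, ?_⟩
    · rw [Finset.set_biUnion_insert]
      exact Set.union_subset (hJF.trans Set.subset_union_right)
        (Set.inter_subset_left.trans Set.subset_union_left)
    · refine Set.disjoint_right.2 ?_
      rintro _ ⟨g, hg, rfl⟩
      exact hg.2.1
    · refine Set.disjoint_right.2 ?_
      rintro _ ⟨g, hg, rfl⟩
      exact hg.2.2
    · intro g hg
      rw [Finset.set_biUnion_insert] at hg
      rw [Set.image_union, Set.image_union]
      rcases hg with hg | hg
      · by_cases h1 : s g ∈ s '' J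
        · exact Or.inl (Or.inl h1)
        by_cases h2 : r g ∈ r '' J
        · exact Or.inr (Or.inl h2)
        exact Or.inl (Or.inr ⟨g, ⟨hg, h1, h2⟩, rfl⟩)
      · exact (hmax g hg).imp Or.inl Or.inl

end EtaleGpd

/-! ### Elementary subgroupoids: orbits, double cosets and matchings -/

namespace EtaleGpd

open GroupoidStr

section Fibres

variable {G : Type*} [TopologicalSpace G] [GroupoidStr G] [EtaleGroupoid G]
  [CompactSpace (UnitSpace G)] [TotallyDisconnectedSpace (UnitSpace G)]

theorem exists_ncard_sourceFiber_le {C : Set G} (hc : IsCompact C) (ho : IsOpen C) :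
    ∃ m : ℕ, ∀ x, (sourceFiber C x).Finite ∧ (sourceFiber C x).ncard ≤ m := by
  obtain ⟨F, hF, rfl⟩ := exists_finset_isBisection hc ho
  have h : ∀ g ∈ ⋃ V ∈ F, V, ∃ V ∈ F, g ∈ V := fun g hg => by simpa using hg
  choose! V hV hgV using h
  refine ⟨F.card, fun x => ?_⟩
  have hm : Set.MapsTo V (sourceFiber (⋃ V ∈ F, V) x) (F : Set (Set G)) :=
    fun g hg => hV g hg.1
  have hi : Set.InjOn V (sourceFiber (⋃ V ∈ F, V) x) := by
    intro g hg g' hg' hVV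
    refine (hF _ (hV g hg.1)).isGSet.eq_of_s (hgV g hg.1) ?_ (hg.2.trans hg'.2.symm)
    rw [hVV]
    exact hgV g' hg'.1
  refine ⟨Set.Finite.of_injOn hm hi F.finite_toSet, ?_⟩
  rw [← Set.ncard_coe_finset]
  exact Set.ncard_le_ncard_of_injOn V hm hi F.finite_toSet

theorem finite_sourceFiber {C : Set G} (hc : IsCompact C) (ho : IsOpen C) (x : UnitSpace G) :
    (sourceFiber C x).Finite :=
  ((exists_ncard_sourceFiber_le hc ho).choose_spec x).1

end Fibres

section DoubleCosets

variable {G : Type*} [TopologicalSpace G] [GroupoidStr G]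

/-- `w` lies in the double coset `KgK`. -/
def DoubleCosetRel (K : Set G) (g w : G) : Prop :=
  ∃ k ∈ K, ∃ k' ∈ K, src k = rng g ∧ src g = rng k' ∧ w = mul (mul k g) k'

namespace IsElementarySubgroupoid

variable {K : Set G} (hK : IsElementarySubgroupoid K)
include hK

theorem units_subset : {x : G | rng x = x} ⊆ K := fun x hx => hK.units_mem x hx

theorem mem_orbit_self (x : UnitSpace G) : x ∈ orbit K x :=
  ⟨x.1, ⟨hK.units_mem _ x.2, s_val x⟩, r_val x⟩

theorem mem_orbit_symm {x y : UnitSpace G} (h : y ∈ orbit K x) : x ∈ orbit K y := by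
  obtain ⟨k, ⟨hk, rfl⟩, rfl⟩ := h
  exact ⟨inv k, ⟨hK.inv_mem k hk, s_inv k⟩, r_inv k⟩

theorem mem_orbit_trans {x y z : UnitSpace G} (h : y ∈ orbit K x) (h' : z ∈ orbit K y) :
    z ∈ orbit K x := by
  obtain ⟨k, ⟨hk, rfl⟩, rfl⟩ := h
  obtain ⟨k', ⟨hk', hkk⟩, rfl⟩ := h'
  have hkk := s_eq_r_iff.1 hkk
  exact ⟨mul k' k, ⟨hK.mul_mem _ hk' _ hk hkk, s_mul hkk⟩, r_mul hkk⟩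

theorem rel_refl (g : G) : DoubleCosetRel K g g :=
  ⟨rng g, hK.units_mem _ (rng_rng g), src g, hK.units_mem _ (rng_src g), src_rng g,
    (rng_src g).symm, by rw [rng_mul_self, mul_src_self]⟩

theorem rel_mul_left {k g : G} (hk : k ∈ K) (h : src k = rng g) :
    DoubleCosetRel K g (mul k g) :=
  ⟨k, hk, src g, hK.units_mem _ (rng_src g), h, (rng_src g).symm, by
    rw [← src_mul _ _ h, mul_src_self]⟩

theorem rel_mul_right {k g : G} (hk : k ∈ K) (h : src g = rng k) :
    DoubleCosetRel K g (mul g k) :=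
  ⟨rng g, hK.units_mem _ (rng_rng g), k, hk, src_rng g, h, by rw [rng_mul_self]⟩

theorem rel_trans {g w v : G} (h : DoubleCosetRel K g w) (h' : DoubleCosetRel K w v) :
    DoubleCosetRel K g v := by
  obtain ⟨k, hk, k', hk', h1, h2, rfl⟩ := h
  obtain ⟨l, hl, l', hl', h3, h4, rfl⟩ := h'
  have h5 : src (mul k g) = rng k' := by rw [src_mul _ _ h1, h2]
  rw [rng_mul _ _ h5, rng_mul _ _ h1] at h3
  rw [src_mul _ _ h5] at h4
  have h6 : src (mul l k) = rng g := by rw [src_mul _ _ h3, h1]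
  have h7 : src g = rng (mul k' l') := by rw [rng_mul _ _ h4, h2]
  refine ⟨mul l k, hK.mul_mem _ hl _ hk h3, mul k' l', hK.mul_mem _ hk' _ hl' h4, h6, h7, ?_⟩
  have h8 : src l = rng (mul k g) := by rw [rng_mul _ _ h1, h3]
  have h9 : src (mul (mul l k) g) = rng k' := by rw [src_mul _ _ h6, h2]
  rw [← GroupoidStr.mul_assoc _ _ _ h8 h5, ← GroupoidStr.mul_assoc _ _ _ h3 h1,
    GroupoidStr.mul_assoc _ _ _ h9 h4]

theorem rel_symm {g w : G} (h : DoubleCosetRel K g w) : DoubleCosetRel K w g := by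
  obtain ⟨k, hk, k', hk', h1, h2, rfl⟩ := h
  have h5 : src (mul k g) = rng k' := by rw [src_mul _ _ h1, h2]
  refine ⟨inv k, hK.inv_mem k hk, inv k', hK.inv_mem k' hk', ?_, ?_, ?_⟩
  · rw [src_inv, rng_mul _ _ h5, rng_mul _ _ h1]
  · rw [rng_inv, src_mul _ _ h5]
  · have h6 : src (inv k) = rng (mul k g) := by rw [src_inv, rng_mul _ _ h1]
    rw [← GroupoidStr.mul_assoc _ _ _ h6 h5, inv_mul_cancel_left h1, mul_inv_cancel_right h2]

theorem rel_inv {g w : G} (h : DoubleCosetRel K g w) : DoubleCosetRel K (inv g) (inv w) := by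
  obtain ⟨k, hk, k', hk', h1, h2, rfl⟩ := h
  have h5 : src (mul k g) = rng k' := by rw [src_mul _ _ h1, h2]
  refine ⟨inv k', hK.inv_mem k' hk', inv k, hK.inv_mem k hk, ?_, ?_, ?_⟩
  · rw [src_inv, rng_inv, h2]
  · rw [rng_inv, src_inv, h1]
  · have h6 : src (inv k') = rng (inv g) := by rw [src_inv, rng_inv, h2]
    have h7 : src (inv g) = rng (inv k) := by rw [src_inv, rng_inv, h1]
    rw [inv_mul_rev h5, inv_mul_rev h1, GroupoidStr.mul_assoc _ _ _ h6 h7]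

theorem rel_inv_iff {g w : G} : DoubleCosetRel K (inv g) w ↔ DoubleCosetRel K g (inv w) := by
  constructor
  · intro h
    have := hK.rel_inv h
    rwa [inv_inv] at this
  · intro h
    have := hK.rel_inv h
    rwa [inv_inv] at this

theorem rel_congr {g w w' : G} (h : DoubleCosetRel K w w') :
    DoubleCosetRel K g w ↔ DoubleCosetRel K g w' :=
  ⟨fun h' => hK.rel_trans h' h, fun h' => hK.rel_trans h' (hK.rel_symm h)⟩

theorem mem_of_rel {g w : G} (h : DoubleCosetRel K g w) (hg : g ∈ K) : w ∈ K := by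
  obtain ⟨k, hk, k', hk', h1, h2, rfl⟩ := h
  have h5 : src (mul k g) = rng k' := by rw [src_mul _ _ h1, h2]
  exact hK.mul_mem _ (hK.mul_mem _ hk _ hg h1) _ hk' h5

theorem notMem_of_rel {g w : G} (h : DoubleCosetRel K g w) (hg : g ∉ K) : w ∉ K :=
  fun hw => hg (hK.mem_of_rel (hK.rel_symm h) hw)

end IsElementarySubgroupoid

end DoubleCosets

namespace IsElementarySubgroupoid

variable {G : Type*} [TopologicalSpace G] [GroupoidStr G] [EtaleGroupoid G]
  [CompactSpace (UnitSpace G)] [TotallyDisconnectedSpace (UnitSpace G)]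
  {K : Set G} (hK : IsElementarySubgroupoid K)
include hK

theorem isClopen : IsClopen K := ⟨hK.isCompact.isClosed, hK.isOpen⟩

theorem finite_orbit (x : UnitSpace G) : (orbit K x).Finite :=
  (finite_sourceFiber hK.isCompact hK.isOpen x).image _

theorem exists_ncard_orbit_le : ∃ m : ℕ, ∀ x, (orbit K x).ncard ≤ m := by
  obtain ⟨m, hm⟩ := exists_ncard_sourceFiber_le hK.isCompact hK.isOpen
  exact ⟨m, fun x => (Set.ncard_image_le (hm x).1).trans (hm x).2⟩

theorem finite_rel (g : G) : {w | DoubleCosetRel K g w}.Finite := by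
  have h1 := finite_sourceFiber hK.isCompact hK.isOpen (r g)
  have h2 := (finite_sourceFiber hK.isCompact hK.isOpen (s g)).image inv
  refine (h1.image2 (fun k k' => mul (mul k g) k') h2).subset ?_
  rintro _ ⟨k, hk, k', hk', h1, h2, rfl⟩
  refine ⟨k, ⟨hk, s_eq_r_iff.2 h1⟩, k', ⟨inv k', ⟨hK.inv_mem _ hk', ?_⟩, inv_inv k'⟩, rfl⟩
  rw [s_inv, eq_comm, s_eq_r_iff, h2]

theorem exists_isTau_pow {U : Set G} {γ : UnitSpace G ≃ₜ UnitSpace G} (hU : IsTau U γ)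
    (hUK : U ⊆ K) (n : ℕ) : ∃ V ⊆ K, IsTau V (γ ^ n) := by
  induction n with
  | zero => exact ⟨_, hK.units_subset, by rw [pow_zero]; exact isTau_one⟩
  | succ n ih =>
    obtain ⟨V, hVK, hV⟩ := ih
    refine ⟨setMul V U, ?_, by rw [pow_succ]; exact hV.mul hU⟩
    rintro _ ⟨v, hv, u, hu, huv, rfl⟩
    exact hK.mul_mem _ (hVK hv) _ (hUK hu) huv

/-- The elements of the full group of an elementary subgroupoid are elementary: orbits have
bounded size, and, `K` being principal, a power fixes exactly the points at which its arrow is a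
unit. -/
theorem isElementaryHomeo {U : Set G} {γ : UnitSpace G ≃ₜ UnitSpace G} (hU : IsTau U γ)
    (hUK : U ⊆ K) : IsElementaryHomeo γ := by
  refine ⟨?_, fun k => ?_⟩
  · obtain ⟨m, hm⟩ := hK.exists_ncard_orbit_le
    refine isOfFinOrder_iff_pow_eq_one.2 ⟨m.factorial, m.factorial_pos, ?_⟩
    ext1 x
    have hmaps : ∀ i ∈ Finset.range (m + 1), (γ ^ i) x ∈ (hK.finite_orbit x).toFinset := by
      intro i _
      obtain ⟨V, hVK, hV⟩ := hK.exists_isTau_pow hU hUK i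
      obtain ⟨v, hv, rfl⟩ : x ∈ s '' V := hV.image_s ▸ Set.mem_univ x
      rw [Set.Finite.mem_toFinset, hV.apply_s v hv]
      exact ⟨v, ⟨hVK hv, rfl⟩, rfl⟩
    have hcard : (hK.finite_orbit x).toFinset.card < (Finset.range (m + 1)).card := by
      rw [Finset.card_range, ← Set.ncard_eq_toFinset_card _ (hK.finite_orbit x)]
      exact Nat.lt_succ_of_le (hm x)
    have key : ∀ i j : ℕ, i < j → j < m + 1 → (γ ^ i) x = (γ ^ j) x →
        (γ ^ m.factorial) x = x := by
      intro i j hij hj he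
      obtain ⟨d, rfl⟩ := Nat.exists_eq_add_of_le hij.le
      have h1 : (γ ^ d) x = x := by
        rw [pow_add] at he
        exact ((γ ^ i).injective he).symm
      obtain ⟨c, hc⟩ := Nat.dvd_factorial (show 0 < d by omega) (show d ≤ m by omega)
      rw [hc, pow_mul]
      clear hc
      induction c with
      | zero => rfl
      | succ c ih =>
        rw [pow_succ]
        change ((γ ^ d) ^ c) ((γ ^ d) x) = x
        rw [h1, ih]
    obtain ⟨i, hi, j, hj, hij, he⟩ := Finset.exists_ne_map_eq_of_card_lt_of_maps_to hcard hmaps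
    rw [Finset.mem_range] at hi hj
    rcases lt_or_gt_of_ne hij with h | h
    · exact key i j h hj he
    · exact key j i h hi he.symm
  · obtain ⟨V, hVK, hV⟩ := hK.exists_isTau_pow hU hUK k
    have : {x | (γ ^ k) x = x} = s '' (V ∩ {g | rng g = g}) := by
      ext x
      constructor
      · intro hx
        obtain ⟨v, hv, rfl⟩ : x ∈ s '' V := hV.image_s ▸ Set.mem_univ x
        have hx : (γ ^ k) (s v) = s v := hx
        rw [hV.apply_s v hv, eq_comm, s_eq_r_iff] at hx
        exact ⟨v, ⟨hv, hK.principal v (hVK hv) hx.symm⟩, rfl⟩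
      · rintro ⟨v, ⟨hv, hvu⟩, rfl⟩
        change (γ ^ k) (s v) = s v
        rw [hV.apply_s v hv]
        exact Subtype.ext ((hvu : rng v = v).trans (src_unit hvu).symm)
    rw [this]
    have hb := hV.isBisection.inter isClopen_units
    exact isClopen_image_s hb.isCompact hb.isOpen

theorem ncard_image_r_inter_orbit {Q : Set G} (hQ : IsBisection Q) (hQK : Q ⊆ K)
    (x : UnitSpace G) : (r '' Q ∩ orbit K x).ncard = (s '' Q ∩ orbit K x).ncard := by
  have h1 : r '' Q ∩ orbit K x = r '' (Q ∩ s ⁻¹' orbit K x) := by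
    ext y
    constructor
    · rintro ⟨⟨q, hq, rfl⟩, hy⟩
      exact ⟨q, ⟨hq, hK.mem_orbit_trans hy
        (hK.mem_orbit_symm ⟨q, ⟨hQK hq, rfl⟩, rfl⟩)⟩, rfl⟩
    · rintro ⟨q, ⟨hq, hy⟩, rfl⟩
      exact ⟨⟨q, hq, rfl⟩, hK.mem_orbit_trans hy ⟨q, ⟨hQK hq, rfl⟩, rfl⟩⟩
  have h2 : s '' Q ∩ orbit K x = s '' (Q ∩ s ⁻¹' orbit K x) := by
    rw [Set.image_inter_preimage]
  rw [h1, h2, (hQ.isGSet.1.mono Set.inter_subset_left).ncard_image,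
    (hQ.isGSet.2.mono Set.inter_subset_left).ncard_image]

/-- A clopen set with no more points than `B` in each `K`-orbit is moved into `B` by a compact open
`G`-set in `K`: a maximal one leaves no point out, by counting. -/
theorem exists_isBisection_image_subset {A B : Set (UnitSpace G)} (hA : IsClopen A)
    (hB : IsClopen B) (h : ∀ x, (A ∩ orbit K x).ncard ≤ (B ∩ orbit K x).ncard) :
    ∃ Q ⊆ K, IsBisection Q ∧ s '' Q = A ∧ r '' Q ⊆ B := by
  have hcl : IsClopen (s ⁻¹' A ∩ r ⁻¹' B : Set G) :=
    (hA.preimage isLocalHomeomorph_s.continuous).inter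
      (hB.preimage isLocalHomeomorph_r.continuous)
  obtain ⟨Q, hQR, hQ, hmax⟩ := exists_maximal_isBisection
    (hK.isCompact.inter_right hcl.isClosed) (hK.isOpen.inter hcl.isOpen)
  have hQK : Q ⊆ K := hQR.trans Set.inter_subset_left
  have hsA : s '' Q ⊆ A := by
    rintro _ ⟨q, hq, rfl⟩
    exact (hQR hq).2.1
  have hrB : r '' Q ⊆ B := by
    rintro _ ⟨q, hq, rfl⟩
    exact (hQR hq).2.2
  refine ⟨Q, hQK, hQ, hsA.antisymm fun a ha => ?_, hrB⟩
  by_contra hna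
  have hfin := hK.finite_orbit a
  have h1 : (s '' Q ∩ orbit K a).ncard < (A ∩ orbit K a).ncard := by
    refine Set.ncard_lt_ncard ⟨Set.inter_subset_inter_left _ hsA, fun hsub => ?_⟩
      (hfin.subset Set.inter_subset_right)
    exact hna (hsub ⟨ha, hK.mem_orbit_self a⟩).1
  rw [← hK.ncard_image_r_inter_orbit hQ hQK] at h1
  obtain ⟨b, ⟨hbB, hbo⟩, hb⟩ := Set.exists_mem_notMem_of_ncard_lt_ncard (h1.trans_le (h a))
    (hfin.subset Set.inter_subset_right)
  obtain ⟨k, ⟨hk, rfl⟩, rfl⟩ := id hbo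
  rcases hmax k ⟨hk, ha, hbB⟩ with h2 | h2
  · exact hna h2
  · exact hb ⟨h2, hbo⟩

/-- A family of clopen sets that fits by cardinality into `B` on every `K`-orbit is moved by compact
open `G`-sets in `K` onto pairwise disjoint subsets of `B`. -/
theorem exists_isBisection_family {ι : Type*} (t : Finset ι) (A : ι → Set (UnitSpace G))
    (hA : ∀ i, IsClopen (A i)) {B : Set (UnitSpace G)} (hB : IsClopen B)
    (h : ∀ x, ∑ i ∈ t, (A i ∩ orbit K x).ncard ≤ (B ∩ orbit K x).ncard) :
    ∃ Q : ι → Set G, (∀ i ∈ t, Q i ⊆ K ∧ IsBisection (Q i) ∧ s '' Q i = A i ∧ r '' Q i ⊆ B) ∧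
      (t : Set ι).PairwiseDisjoint fun i => r '' Q i := by
  classical
  induction t using Finset.induction_on generalizing B with
  | empty => exact ⟨fun _ => ∅, by simp, by simp⟩
  | insert a t ha ih =>
    simp only [Finset.sum_insert ha] at h
    obtain ⟨P, hPK, hP, hsP, hrP⟩ := hK.exists_isBisection_image_subset (hA a) hB
      fun x => (Nat.le_add_right _ _).trans (h x)
    have hP' := isClopen_image_r hP.isCompact hP.isOpen
    obtain ⟨Q, hQ, hQd⟩ := ih (hB.inter hP'.compl) fun x => by
      have h1 := h x
      have h2 := hK.ncard_image_r_inter_orbit hP hPK x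
      rw [hsP] at h2
      have h3 : (r '' P ∩ orbit K x) ⊆ (B ∩ orbit K x) := Set.inter_subset_inter_left _ hrP
      have h4 := Set.ncard_sdiff_add_ncard_of_subset h3
        ((hK.finite_orbit x).subset Set.inter_subset_right)
      have h5 : (B ∩ orbit K x) \ (r '' P ∩ orbit K x) = B ∩ (r '' P)ᶜ ∩ orbit K x := by
        ext y
        simp only [Set.mem_sdiff, Set.mem_inter_iff, Set.mem_compl_iff]
        tauto
      rw [h5] at h4
      omega
    have hne : ∀ i ∈ t, i ≠ a := fun i hi hia => ha (hia ▸ hi)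
    refine ⟨Function.update Q a P, ?_, ?_⟩
    · intro i hi
      rcases Finset.mem_insert.1 hi with rfl | hi
      · rw [Function.update_self]
        exact ⟨hPK, hP, hsP, hrP⟩
      · rw [Function.update_of_ne (hne i hi)]
        obtain ⟨h1, h2, h3, h4⟩ := hQ i hi
        exact ⟨h1, h2, h3, h4.trans Set.inter_subset_left⟩
    · have hd : ∀ i ∈ t, Disjoint (r '' P) (r '' Q i) := fun i hi =>
        Set.disjoint_right.2 fun y hy => ((hQ i hi).2.2.2 hy).2
      rw [Finset.coe_insert, Set.pairwiseDisjoint_insert_of_notMem (by simpa using ha)]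
      refine ⟨fun i hi j hj hij => ?_, fun j hj => ?_⟩
      · simp only [Function.onFun, Function.update_of_ne (hne i hi),
          Function.update_of_ne (hne j hj)]
        exact hQd hi hj hij
      · rw [Function.update_self, Function.update_of_ne (hne j hj)]
        exact hd j hj

end IsElementarySubgroupoid

end EtaleGpd

/-! ### Triangles and antisymmetrized boundaries -/

namespace EtaleGpd

open GroupoidStr

section Decomposition

variable {Y : Type*} [TopologicalSpace Y] [T2Space Y]

/-- The product of `f` with the characteristic function of a clopen set. -/
noncomputable def restrictClopen (f : C_c(Y, ℤ)) (F : Set Y) (hF : IsClopen F) : C_c(Y, ℤ) where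
  toFun := F.indicator f
  continuous_toFun := hF.continuous_indicator f.continuous
  hasCompactSupport' := HasCompactSupport.intro f.hasCompactSupport.isCompact fun y hy => by
    rw [Set.indicator_apply_eq_zero]
    exact fun _ => image_eq_zero_of_notMem_tsupport hy

/-- The characteristic function of a compact open set of a Hausdorff space. -/
noncomputable def indicatorCc (E : Set Y) (hc : IsCompact E) (ho : IsOpen E) : C_c(Y, ℤ) where
  toFun := E.indicator 1
  continuous_toFun := IsClopen.continuous_indicator ⟨hc.isClosed, ho⟩ continuous_const
  hasCompactSupport' := HasCompactSupport.intro hc fun _ hx => Set.indicator_of_notMem hx _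

/-- If the sets satisfying `P` are compact open, cover `Y` and are stable under passing to clopen
subsets, then their characteristic functions generate `C_c(Y, ℤ)`. -/
theorem mem_closure_indicator (P : Set Y → Prop) (hP : ∀ E, P E → IsCompact E ∧ IsOpen E)
    (hmono : ∀ E F, P E → IsClopen F → P (E ∩ F)) (hcov : ∀ y, ∃ E, P E ∧ y ∈ E)
    (f : C_c(Y, ℤ)) :
    f ∈ AddSubgroup.closure {h : C_c(Y, ℤ) | ∃ E, P E ∧ ⇑h = E.indicator 1} := by
  classical
  choose E hE hyE using hcov
  obtain ⟨t, -, ht⟩ := f.hasCompactSupport.isCompact.elim_nhds_subcover E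
    fun y _ => (hP _ (hE y)).2.mem_nhds (hyE y)
  have hsupp : ∀ y, f y ≠ 0 → y ∈ ⋃ x ∈ t, E x := fun y hy => ht (subset_tsupport _ hy)
  clear ht
  induction t using Finset.induction_on generalizing f with
  | empty =>
    have : f = 0 := by
      ext y
      by_contra hy
      simpa using hsupp y hy
    rw [this]
    exact zero_mem _
  | insert a t _ ih =>
    have hEa : IsClopen (E a) := ⟨(hP _ (hE a)).1.isClosed, (hP _ (hE a)).2⟩
    have hsum : f = restrictClopen f (E a) hEa + restrictClopen f (E a)ᶜ hEa.compl := by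
      ext y
      exact (Set.indicator_self_add_compl_apply (E a) f y).symm
    rw [hsum]
    refine add_mem ?_ (ih _ fun y hy => ?_)
    · have hfin : (f '' E a).Finite :=
        ((hP _ (hE a)).1.image f.continuous).finite_of_discrete
      have hcl : ∀ c : ℤ, IsClopen (f ⁻¹' {c}) := fun c =>
        (isClopen_discrete {c}).preimage f.continuous
      have hPc : ∀ c : ℤ, P (E a ∩ f ⁻¹' {c}) := fun c => hmono _ _ (hE a) (hcl c)
      have : restrictClopen f (E a) hEa = ∑ c ∈ hfin.toFinset,
          c • indicatorCc (E a ∩ f ⁻¹' {c}) (hP _ (hPc c)).1 (hP _ (hPc c)).2 := by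
        ext y
        rw [CompactlySupportedContinuousMap.sum_apply]
        change (E a).indicator f y = ∑ c ∈ hfin.toFinset, c • (E a ∩ f ⁻¹' {c}).indicator 1 y
        by_cases hy : y ∈ E a
        · rw [Set.indicator_of_mem hy, Finset.sum_eq_single (f y)]
          · have hy' : y ∈ E a ∩ f ⁻¹' {f y} := ⟨hy, rfl⟩
            rw [Set.indicator_of_mem hy']
            simp
          · intro c _ hc
            rw [Set.indicator_of_notMem (fun h => hc (h.2 : f y = c).symm), smul_zero]
          · intro h
            exact (h (hfin.mem_toFinset.2 (Set.mem_image_of_mem f hy))).elim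
        · rw [Set.indicator_of_notMem hy, Finset.sum_eq_zero]
          intro c _
          rw [Set.indicator_of_notMem (fun h => hy h.1), smul_zero]
      rw [this]
      refine sum_mem fun c _ => zsmul_mem (AddSubgroup.subset_closure ?_) c
      exact ⟨_, hPc c, rfl⟩
    · have hy : (E a)ᶜ.indicator f y ≠ 0 := hy
      have h1 := Set.mem_of_indicator_ne_zero hy
      rw [Set.indicator_of_mem h1] at hy
      have h2 := hsupp y hy
      rw [Finset.set_biUnion_insert] at h2
      exact h2.resolve_left h1

theorem pushforward_of_eq_indicator {X : Type*} [TopologicalSpace X] [T2Space X] {p : Y → X}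
    (hp : IsLocalHomeomorph p) {E : Set Y} (hE : Set.InjOn p E) {f : C_c(Y, ℤ)}
    (hf : ⇑f = E.indicator 1) (x : X) : pushforward p hp f x = (p '' E).indicator 1 x := by
  rw [pushforward_apply, hf]
  by_cases hx : x ∈ p '' E
  · obtain ⟨y, hy, rfl⟩ := hx
    have h : p ⁻¹' {p y} ∩ Function.support (E.indicator (1 : Y → ℤ)) = {y} := by
      ext z
      simp only [Set.mem_inter_iff, Set.mem_preimage, Set.mem_singleton_iff,
        Function.mem_support, ne_eq, Set.indicator_apply_eq_zero, Pi.one_apply, one_ne_zero,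
        imp_false, not_not]
      exact ⟨fun ⟨h1, h2⟩ => hE h2 hy h1, fun h => by subst h; exact ⟨rfl, hy⟩⟩
    rw [← finsum_mem_inter_support, h, finsum_mem_singleton, Set.indicator_of_mem hy,
      Set.indicator_of_mem (Set.mem_image_of_mem p hy)]
    rfl
  · rw [Set.indicator_of_notMem hx]
    refine finsum_mem_eq_zero_of_forall_eq_zero fun y hy => ?_
    exact Set.indicator_of_notMem (fun h => hx ⟨y, h, hy⟩) _

end Decomposition

section Simplices

variable {G : Type*} [GroupoidStr G]

/-- The edges of the triangle spanned by a composable pair `p = (g, h)`, oriented cyclically: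
`h`, then `g`, then `(gh)⁻¹`. -/
def edge : Fin 3 → ComposablePairs G → G := ![d₀, d₂, fun p => inv (d₁ p)]

/-- The antisymmetrization `g ↦ φ(g) - φ(g⁻¹)`. -/
def antisymm (φ : G → ℤ) (g : G) : ℤ := φ g - φ (inv g)

theorem src_d₁ (p : ComposablePairs G) : src (d₁ p) = src p.1.2 := src_mul _ _ p.2

theorem rng_d₁ (p : ComposablePairs G) : rng (d₁ p) = rng p.1.1 := rng_mul _ _ p.2

theorem src_edge_succ (j : Fin 3) (p : ComposablePairs G) :
    src (edge (j + 1) p) = rng (edge j p) := by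
  fin_cases j
  · exact p.2
  · exact (src_inv _).trans (rng_d₁ p)
  · exact ((rng_inv _).trans (src_d₁ p)).symm

theorem edge_mul_edge (j : Fin 3) (p : ComposablePairs G) :
    mul (edge (j + 1) p) (edge j p) = inv (edge (j + 2) p) := by
  fin_cases j
  · exact (inv_inv _).symm
  · change mul (inv (mul p.1.1 p.1.2)) p.1.1 = inv p.1.2
    have h : src (inv p.1.2) = rng (inv p.1.1) := by rw [src_inv, rng_inv, p.2]
    have := mul_inv_cancel_right h
    rwa [← inv_mul_rev p.2, inv_inv] at this
  · change mul p.1.2 (inv (mul p.1.1 p.1.2)) = inv p.1.1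
    have h : src (inv p.1.2) = rng (inv p.1.1) := by rw [src_inv, rng_inv, p.2]
    have := inv_mul_cancel_left h
    rwa [← inv_mul_rev p.2, inv_inv] at this

end Simplices

variable {G : Type*} [TopologicalSpace G] [GroupoidStr G] [EtaleGroupoid G]

theorem isLocalHomeomorph_edge (j : Fin 3) :
    IsLocalHomeomorph (edge j : ComposablePairs G → G) := by
  fin_cases j
  · exact isLocalHomeomorph_d₀
  · exact isLocalHomeomorph_d₂
  · exact (invHomeo G).isLocalHomeomorph.comp isLocalHomeomorph_d₁

/-- A compact open set of composable pairs on which each vertex of the triangle determines the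
pair. -/
structure IsSimplexSet (E : Set (ComposablePairs G)) : Prop where
  isCompact : IsCompact E
  isOpen : IsOpen E
  injOn : ∀ j, Set.InjOn (fun p => s (edge j p)) E

namespace IsSimplexSet

variable {E : Set (ComposablePairs G)}

theorem inter (h : IsSimplexSet E) {F : Set (ComposablePairs G)} (hF : IsClopen F) :
    IsSimplexSet (E ∩ F) :=
  ⟨h.isCompact.inter_right hF.isClosed, h.isOpen.inter hF.isOpen,
    fun j => (h.injOn j).mono Set.inter_subset_left⟩

theorem injOn_r (h : IsSimplexSet E) (j : Fin 3) : Set.InjOn (fun p => r (edge j p)) E := by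
  intro p hp q hq hpq
  refine h.injOn (j + 1) hp hq ?_
  change s _ = s _
  rw [s_eq_s_iff, src_edge_succ, src_edge_succ]
  exact r_eq_r_iff.1 hpq

theorem injOn_edge (h : IsSimplexSet E) (j : Fin 3) : Set.InjOn (edge j) E :=
  fun _ hp _ hq hpq => h.injOn j hp hq (congrArg s hpq)

theorem isBisection_image (h : IsSimplexSet E) (j : Fin 3) : IsBisection (edge j '' E) := by
  refine ⟨h.isCompact.image (isLocalHomeomorph_edge j).continuous,
    (isLocalHomeomorph_edge j).isOpenMap _ h.isOpen, ?_, ?_⟩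
  · rintro _ ⟨p, hp, rfl⟩ _ ⟨q, hq, rfl⟩ hpq
    rw [h.injOn_r j hp hq hpq]
  · rintro _ ⟨p, hp, rfl⟩ _ ⟨q, hq, rfl⟩ hpq
    rw [h.injOn j hp hq hpq]

theorem flip (h : IsSimplexSet E) : IsSimplexSet (flipHomeo G '' E) := by
  refine ⟨h.isCompact.image (flipHomeo G).continuous, (flipHomeo G).isOpenMap _ h.isOpen, ?_⟩
  have key : ∀ p : ComposablePairs G, edge 0 (flipHomeo G p) = inv (edge 1 p) ∧
      edge 1 (flipHomeo G p) = inv (edge 0 p) ∧ edge 2 (flipHomeo G p) = inv (edge 2 p) :=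
    fun p => ⟨rfl, rfl, congrArg inv (inv_mul_rev p.2).symm⟩
  rintro j _ ⟨p, hp, rfl⟩ _ ⟨q, hq, rfl⟩ hpq
  have hpq : s (edge j (flipHomeo G p)) = s (edge j (flipHomeo G q)) := hpq
  congr 1
  fin_cases j
  · refine h.injOn_r 1 hp hq ?_
    change r _ = r _
    rw [← s_inv, ← s_inv, ← (key p).1, ← (key q).1]
    exact hpq
  · refine h.injOn_r 0 hp hq ?_
    change r _ = r _
    rw [← s_inv, ← s_inv, ← (key p).2.1, ← (key q).2.1]
    exact hpq
  · refine h.injOn_r 2 hp hq ?_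
    change r _ = r _
    rw [← s_inv, ← s_inv, ← (key p).2.2, ← (key q).2.2]
    exact hpq

end IsSimplexSet

theorem antisymm_indicator_image_inv (S : Set G) (g : G) :
    antisymm ((inv '' S).indicator 1) g = - antisymm (S.indicator 1) g := by
  classical
  have h : ∀ g, (inv '' S).indicator (1 : G → ℤ) g = S.indicator 1 (inv g) := by
    intro g
    have : g ∈ inv '' S ↔ inv g ∈ S := by
      constructor
      · rintro ⟨x, hx, rfl⟩
        rwa [inv_inv]
      · exact fun h => ⟨_, h, inv_inv g⟩
    simp only [Set.indicator_apply, this]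
    rfl
  rw [antisymm, antisymm, h, h, inv_inv, neg_sub]

/-- Reversing triangles changes the sign of the antisymmetrized boundary. -/
theorem sum_antisymm_flip (E : Set (ComposablePairs G)) (g : G) :
    ∑ j, antisymm ((edge j '' (flipHomeo G '' E)).indicator 1) g =
      - ∑ j, antisymm ((edge j '' E).indicator 1) g := by
  have h0 : edge 0 '' (flipHomeo G '' E) = inv '' (edge 1 '' E) := by
    rw [Set.image_image, Set.image_image]
    rfl
  have h1 : edge 1 '' (flipHomeo G '' E) = inv '' (edge 0 '' E) := by
    rw [Set.image_image, Set.image_image]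
    rfl
  have h2 : edge 2 '' (flipHomeo G '' E) = inv '' (edge 2 '' E) := by
    rw [Set.image_image, Set.image_image]
    exact Set.image_congr fun p _ => congrArg inv (inv_mul_rev p.2).symm
  rw [Fin.sum_univ_three, Fin.sum_univ_three, h0, h1, h2, antisymm_indicator_image_inv,
    antisymm_indicator_image_inv, antisymm_indicator_image_inv]
  ring

theorem antisymm_boundary₂_indicator {E : Set (ComposablePairs G)} (hE : IsSimplexSet E)
    {f : C_c(ComposablePairs G, ℤ)} (hf : ⇑f = E.indicator 1) (g : G) :
    antisymm (boundary₂ G f) g = ∑ j, antisymm ((edge j '' E).indicator 1) g := by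
  have hd : ∀ g, boundary₂ G f g = (edge 0 '' E).indicator 1 g - (d₁ '' E).indicator 1 g
      + (edge 1 '' E).indicator 1 g := by
    intro g
    have hi : Set.InjOn (d₁ : ComposablePairs G → G) E := fun p hp q hq hpq =>
      hE.injOn_edge 2 hp hq (congrArg inv hpq)
    rw [← pushforward_of_eq_indicator (isLocalHomeomorph_edge 0) (hE.injOn_edge 0) hf,
      ← pushforward_of_eq_indicator (isLocalHomeomorph_edge 1) (hE.injOn_edge 1) hf,
      ← pushforward_of_eq_indicator isLocalHomeomorph_d₁ hi hf]
    rfl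
  have h2 : edge 2 '' E = inv '' (d₁ '' E) := by
    rw [Set.image_image]
    rfl
  rw [Fin.sum_univ_three, h2, antisymm_indicator_image_inv]
  simp only [antisymm, hd]
  ring

variable [CompactSpace (UnitSpace G)] [TotallyDisconnectedSpace (UnitSpace G)]

theorem exists_isSimplexSet_mem (p : ComposablePairs G) : ∃ E, IsSimplexSet E ∧ p ∈ E := by
  have h : ∀ j, IsLocalHomeomorph fun p : ComposablePairs G => s (edge j p) := fun j =>
    isLocalHomeomorph_s.comp (isLocalHomeomorph_edge j)
  obtain ⟨V, hVc, hVo, hVi, hpV, -⟩ :=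
    (h 0).exists_isCompact_isOpen_injOn isOpen_univ (Set.mem_univ p)
  obtain ⟨W, hWc, hWo, hWi, hpW, hWV⟩ := (h 1).exists_isCompact_isOpen_injOn hVo hpV
  obtain ⟨E, hEc, hEo, hEi, hpE, hEW⟩ := (h 2).exists_isCompact_isOpen_injOn hWo hpW
  refine ⟨E, ⟨hEc, hEo, fun j => ?_⟩, hpE⟩
  fin_cases j
  · exact hVi.mono (hEW.trans hWV)
  · exact hWi.mono hEW
  · exact hEi

/-- The antisymmetrization of a boundary is a sum of antisymmetrized boundaries of triangles, all
with coefficient `1`, the triangles with a negative coefficient being reversed. -/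
theorem exists_antisymm_boundary₂_eq_sum (f : C_c(ComposablePairs G, ℤ)) :
    ∃ (ι : Type) (_ : Fintype ι) (E : ι → Set (ComposablePairs G)),
      (∀ i, IsSimplexSet (E i)) ∧ ∀ g, antisymm (boundary₂ G f) g =
        ∑ i, ∑ j, antisymm ((edge j '' E i).indicator 1) g := by
  have hf := mem_closure_indicator (IsSimplexSet (G := G)) (fun E hE => ⟨hE.isCompact, hE.isOpen⟩)
    (fun E F hE hF => hE.inter hF) exists_isSimplexSet_mem f
  induction hf using AddSubgroup.closure_induction with
  | mem f hf =>
    obtain ⟨E, hE, hf⟩ := hf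
    refine ⟨Unit, inferInstance, fun _ => E, fun _ => hE, fun g => ?_⟩
    rw [antisymm_boundary₂_indicator hE hf]
    exact (Fintype.sum_unique (ι := Unit) fun _ =>
      ∑ j, antisymm ((edge j '' E).indicator 1) g).symm
  | zero =>
    refine ⟨Empty, inferInstance, Empty.elim, fun i => i.elim, fun g => ?_⟩
    simp [antisymm]
  | add f f' _ _ ih ih' =>
    obtain ⟨ι, hι, E, hE, h⟩ := ih
    obtain ⟨ι', hι', E', hE', h'⟩ := ih'
    refine ⟨ι ⊕ ι', inferInstance, Sum.elim E E', ?_, fun g => ?_⟩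
    · rintro (i | i)
      · exact hE i
      · exact hE' i
    · rw [Fintype.sum_sum_type]
      simp only [Sum.elim_inl, Sum.elim_inr]
      rw [← h, ← h', map_add]
      simp only [antisymm, CompactlySupportedContinuousMap.add_apply]
      ring
  | neg f _ ih =>
    obtain ⟨ι, hι, E, hE, h⟩ := ih
    refine ⟨ι, hι, fun i => flipHomeo G '' E i, fun i => (hE i).flip, fun g => ?_⟩
    simp only [sum_antisymm_flip]
    rw [Finset.sum_neg_distrib, ← h, map_neg]
    simp only [antisymm, CompactlySupportedContinuousMap.neg_apply]
    ring

end EtaleGpd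

/-! ### Counting in double cosets -/

namespace EtaleGpd

open GroupoidStr

/-- The number of elements of `S` in the double coset `KgK`. -/
noncomputable def cosetCount {G : Type*} [TopologicalSpace G] [GroupoidStr G] (K S : Set G)
    (g : G) : ℕ := (S ∩ {w | DoubleCosetRel K g w}).ncard

namespace IsElementarySubgroupoid

variable {G : Type*} [TopologicalSpace G] [GroupoidStr G] [EtaleGroupoid G]
  [CompactSpace (UnitSpace G)] [TotallyDisconnectedSpace (UnitSpace G)]
  {K : Set G} (hK : IsElementarySubgroupoid K)
include hK

theorem sum_indicator_coset (S : Set G) (g : G) :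
    ∑ w ∈ (hK.finite_rel g).toFinset, S.indicator (1 : G → ℤ) w = cosetCount K S g := by
  classical
  have h : S ∩ {w | DoubleCosetRel K g w} =
      ((hK.finite_rel g).toFinset.filter (· ∈ S) : Set G) := by
    ext w
    simp [and_comm]
  rw [cosetCount, h, Set.ncard_coe_finset, Finset.card_filter]
  push_cast
  exact Finset.sum_congr rfl fun w _ => by simp [Set.indicator_apply]

theorem sum_antisymm_indicator_coset (S : Set G) (g : G) :
    ∑ w ∈ (hK.finite_rel g).toFinset, antisymm (S.indicator 1) w =
      cosetCount K S g - cosetCount K S (inv g) := by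
  rw [← hK.sum_indicator_coset, ← hK.sum_indicator_coset, ← sub_eq_zero]
  simp only [antisymm, Finset.sum_sub_distrib]
  rw [sub_sub_sub_cancel_left, sub_eq_zero]
  refine Finset.sum_nbij' inv inv ?_ ?_ (fun w _ => inv_inv w) (fun w _ => inv_inv w) ?_
  · intro w hw
    rw [Set.Finite.mem_toFinset] at hw ⊢
    have hw : DoubleCosetRel K (inv g) w := hw
    exact hK.rel_inv_iff.1 hw
  · intro w hw
    rw [Set.Finite.mem_toFinset] at hw ⊢
    exact hK.rel_inv hw
  · intro w _
    rw [inv_inv]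

theorem cosetCount_setMul_left {Q S : Set G} (hQK : Q ⊆ K) (hQ : IsGSet Q) (hS : IsGSet S)
    (h : r '' S ⊆ s '' Q) (g : G) : cosetCount K (setMul Q S) g = cosetCount K S g := by
  have himg : s '' (setMul Q S ∩ {w | DoubleCosetRel K g w}) =
      s '' (S ∩ {w | DoubleCosetRel K g w}) := by
    ext x
    constructor
    · rintro ⟨_, ⟨⟨q, hq, w, hw, hqw, rfl⟩, hg⟩, rfl⟩
      exact ⟨w, ⟨hw, (hK.rel_congr (hK.rel_mul_left (hQK hq) hqw)).2 hg⟩, (s_mul hqw).symm⟩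
    · rintro ⟨w, ⟨hw, hg⟩, rfl⟩
      obtain ⟨q, hq, hqw⟩ := h ⟨w, hw, rfl⟩
      have hqw := s_eq_r_iff.1 hqw
      exact ⟨_, ⟨⟨q, hq, w, hw, hqw, rfl⟩,
        (hK.rel_congr (hK.rel_mul_left (hQK hq) hqw)).1 hg⟩, s_mul hqw⟩
  rw [cosetCount, ← ((hQ.setMul hS).2.mono Set.inter_subset_left).ncard_image, himg,
    (hS.2.mono Set.inter_subset_left).ncard_image]
  rfl

theorem cosetCount_setMul_right {Q S : Set G} (hQK : Q ⊆ K) (hQ : IsGSet Q) (hS : IsGSet S)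
    (h : s '' S ⊆ r '' Q) (g : G) : cosetCount K (setMul S Q) g = cosetCount K S g := by
  have himg : r '' (setMul S Q ∩ {w | DoubleCosetRel K g w}) =
      r '' (S ∩ {w | DoubleCosetRel K g w}) := by
    ext x
    constructor
    · rintro ⟨_, ⟨⟨w, hw, q, hq, hwq, rfl⟩, hg⟩, rfl⟩
      exact ⟨w, ⟨hw, (hK.rel_congr (hK.rel_mul_right (hQK hq) hwq)).2 hg⟩, (r_mul hwq).symm⟩
    · rintro ⟨w, ⟨hw, hg⟩, rfl⟩
      obtain ⟨q, hq, hwq⟩ := h ⟨w, hw, rfl⟩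
      have hwq := s_eq_r_iff.1 hwq.symm
      exact ⟨_, ⟨⟨w, hw, q, hq, hwq, rfl⟩,
        (hK.rel_congr (hK.rel_mul_right (hQK hq) hwq)).1 hg⟩, r_mul hwq⟩
  rw [cosetCount, ← ((hS.setMul hQ).1.mono Set.inter_subset_left).ncard_image, himg,
    (hS.1.mono Set.inter_subset_left).ncard_image]
  rfl

theorem cosetCount_union {S S' : Set G} (h : Disjoint S S') (g : G) :
    cosetCount K (S ∪ S') g = cosetCount K S g + cosetCount K S' g := by
  rw [cosetCount, Set.union_inter_distrib_right]
  exact Set.ncard_union_eq (h.mono Set.inter_subset_left Set.inter_subset_left)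
    ((hK.finite_rel g).subset Set.inter_subset_right)
    ((hK.finite_rel g).subset Set.inter_subset_right)

theorem cosetCount_biUnion {α : Type*} (t : Finset α) (S : α → Set G)
    (h : Pairwise (Function.onFun Disjoint S)) (g : G) :
    cosetCount K (⋃ a ∈ t, S a) g = ∑ a ∈ t, cosetCount K (S a) g := by
  classical
  induction t using Finset.induction_on with
  | empty => simp [cosetCount]
  | insert a t ha ih =>
    rw [Finset.set_biUnion_insert, hK.cosetCount_union, ih, Finset.sum_insert ha]
    rw [Set.disjoint_iUnion₂_right]
    exact fun b hb => h fun hab => ha (hab ▸ hb)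

/-- The triangles of `E` none of whose edges lies in `K`. -/
theorem isClopen_edges_notMem : IsClopen {p : ComposablePairs G | ∀ j, edge j p ∉ K} := by
  rw [Set.ofPred_forall]
  exact isClopen_iInter_of_finite fun j =>
    hK.isClopen.compl.preimage (isLocalHomeomorph_edge j).continuous

theorem rel_edge_of_mem {p : ComposablePairs G} {k : Fin 3} (hk : edge k p ∈ K) :
    DoubleCosetRel K (edge (k + 1) p) (inv (edge (k + 2) p)) := by
  rw [← edge_mul_edge]
  exact hK.rel_mul_right hk (src_edge_succ k p)

/-- A triangle with an edge in `K` has no antisymmetrized boundary outside `K`: its two other edges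
are inverse to each other modulo `K`. -/
theorem sum_cosetCount_edge {E : Set (ComposablePairs G)} (hE : IsSimplexSet E) {g : G}
    (hg : g ∉ K) :
    ∑ j, ((cosetCount K (edge j '' E) g : ℤ) - cosetCount K (edge j '' E) (inv g)) =
      ∑ j, ((cosetCount K (edge j '' (E ∩ {p | ∀ j, edge j p ∉ K})) g : ℤ) -
        cosetCount K (edge j '' (E ∩ {p | ∀ j, edge j p ∉ K})) (inv g)) := by
  classical
  set D : Set (ComposablePairs G) := {p | ∀ j, edge j p ∉ K} with hD
  have hfin : ∀ j g, (E ∩ {p | DoubleCosetRel K g (edge j p)}).Finite := fun j g =>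
    Set.Finite.of_finite_image ((hK.finite_rel g).subset (by rintro _ ⟨p, hp, rfl⟩; exact hp.2))
      ((hE.injOn_edge j).mono Set.inter_subset_left)
  have hfin' : (⋃ j, ((E ∩ {p | DoubleCosetRel K g (edge j p)}) ∪
      (E ∩ {p | DoubleCosetRel K (inv g) (edge j p)}))).Finite :=
    Set.finite_iUnion fun j => (hfin j g).union (hfin j (inv g))
  -- The counts are sums over the finite set `P` of triangles with an edge in `KgK` or `Kg⁻¹K`.
  set P := hfin'.toFinset with hP
  have hmemP : ∀ j p, p ∈ E → DoubleCosetRel K g (edge j p) ∨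
      DoubleCosetRel K (inv g) (edge j p) → p ∈ P := by
    intro j p hp h
    rw [hP, Set.Finite.mem_toFinset]
    exact Set.mem_iUnion.2 ⟨j, h.imp (fun h => ⟨hp, h⟩) fun h => ⟨hp, h⟩⟩
  have hcount : ∀ F ⊆ E, ∀ j, ∀ g', (∀ p, p ∈ E → DoubleCosetRel K g' (edge j p) → p ∈ P) →
      (cosetCount K (edge j '' F) g' : ℤ) =
        ∑ p ∈ P, if p ∈ F ∧ DoubleCosetRel K g' (edge j p) then 1 else 0 := by
    intro F hF j g' hg'
    have h1 : edge j '' F ∩ {w | DoubleCosetRel K g' w} =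
        edge j '' (P.filter fun p => p ∈ F ∧ DoubleCosetRel K g' (edge j p) : Set _) := by
      ext w
      constructor
      · rintro ⟨⟨p, hp, rfl⟩, hw⟩
        exact ⟨p, by simpa using ⟨hg' p (hF hp) hw, hp, hw⟩, rfl⟩
      · rintro ⟨p, hp, rfl⟩
        have hp : p ∈ P ∧ p ∈ F ∧ DoubleCosetRel K g' (edge j p) := by simpa using hp
        exact ⟨⟨p, hp.2.1, rfl⟩, hp.2.2⟩
    rw [cosetCount, h1, Set.InjOn.ncard_image, Set.ncard_coe_finset, Finset.card_filter]
    · push_cast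
      rfl
    · intro p hp q hq hpq
      have hp : p ∈ P ∧ p ∈ F ∧ DoubleCosetRel K g' (edge j p) := by simpa using hp
      have hq : q ∈ P ∧ q ∈ F ∧ DoubleCosetRel K g' (edge j q) := by simpa using hq
      exact hE.injOn_edge j (hF hp.2.1) (hF hq.2.1) hpq
  have hsum : ∀ F ⊆ E, ∑ j, ((cosetCount K (edge j '' F) g : ℤ) -
      cosetCount K (edge j '' F) (inv g)) = ∑ p ∈ P, ∑ j,
        ((if p ∈ F ∧ DoubleCosetRel K g (edge j p) then 1 else 0) -
          if p ∈ F ∧ DoubleCosetRel K (inv g) (edge j p) then 1 else 0) := by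
    intro F hF
    rw [Finset.sum_comm]
    refine Finset.sum_congr rfl fun j _ => ?_
    rw [hcount F hF j g fun p hp h => hmemP j p hp (Or.inl h),
      hcount F hF j (inv g) fun p hp h => hmemP j p hp (Or.inr h), Finset.sum_sub_distrib]
  rw [hsum E subset_rfl, hsum (E ∩ D) Set.inter_subset_left]
  refine Finset.sum_congr rfl fun p _ => ?_
  by_cases hpE : p ∈ E
  swap
  · simp [hpE]
  by_cases hpD : p ∈ D
  · simp [hpE, hpD]
  obtain ⟨k, hk⟩ : ∃ k, edge k p ∈ K := by simpa [hD] using hpD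
  have hg' : inv g ∉ K := fun h => hg (by simpa [inv_inv] using hK.inv_mem _ h)
  have h1 : ¬ DoubleCosetRel K g (edge k p) := fun h => hK.notMem_of_rel h hg hk
  have h2 : ¬ DoubleCosetRel K (inv g) (edge k p) := fun h => hK.notMem_of_rel h hg' hk
  have h3 := hK.rel_edge_of_mem hk
  have h4 : DoubleCosetRel K g (edge (k + 1) p) ↔ DoubleCosetRel K (inv g) (edge (k + 2) p) := by
    rw [hK.rel_congr h3, hK.rel_inv_iff]
  have h5 : DoubleCosetRel K (inv g) (edge (k + 1) p) ↔ DoubleCosetRel K g (edge (k + 2) p) := by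
    rw [hK.rel_congr h3, hK.rel_inv_iff, inv_inv]
  have hcyc : ∀ f : Fin 3 → ℤ, ∑ j, f j = f k + f (k + 1) + f (k + 2) := by
    intro f
    rw [Fin.sum_univ_three]
    fin_cases k
    · rfl
    · change _ = f 1 + f 2 + f 0
      ring
    · change _ = f 2 + f 0 + f 1
      ring
  rw [hcyc]
  simp only [hpD, hpE, h1, h2, h4, h5, Set.mem_inter_iff, and_false, false_and, if_false,
    Finset.sum_const_zero, true_and, sub_zero]
  ring

end IsElementarySubgroupoid

end EtaleGpd

/-! ### Factorization of homeomorphisms that are symmetric modulo `K` -/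

namespace EtaleGpd

open GroupoidStr

namespace IsElementarySubgroupoid

variable {G : Type*} [TopologicalSpace G] [GroupoidStr G] [EtaleGroupoid G]
  [CompactSpace (UnitSpace G)] [TotallyDisconnectedSpace (UnitSpace G)]
  {K : Set G} (hK : IsElementarySubgroupoid K)
include hK

/-- If `W` meets `KgK` and `Kg⁻¹K` in the same number of arrows for every `g ∉ K`, then the arrows
of `W` outside `K` can be matched so that matched arrows are inverse to each other modulo `K`. -/
theorem exists_matching {W : Set G} (hW : IsBisection W)
    (hsymm : ∀ g ∉ K, cosetCount K W g = cosetCount K W (inv g)) :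
    ∃ J ⊆ setMul K (W \ K), (∀ g ∈ J, inv g ∈ setMul K (W \ K)) ∧ IsBisection J ∧
      s '' J = s '' (W \ K) ∧ r '' J = s '' (W \ K) := by
  have hW' : IsBisection (W \ K) := hW.diff hK.isClopen
  have hKW : IsCompact (setMul K (W \ K)) := isCompact_setMul hK.isCompact hW'.isCompact
  have hKW' : IsOpen (setMul K (W \ K)) := isOpen_setMul hK.isOpen hW'.isOpen
  obtain ⟨J, hJR, hJ, hmax⟩ := exists_maximal_isBisection
    (hKW.inter_right (hKW.isClosed.preimage EtaleGroupoid.continuous_inv))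
    (hKW'.inter (hKW'.preimage EtaleGroupoid.continuous_inv))
  have hJs : J ⊆ setMul K (W \ K) := hJR.trans Set.inter_subset_left
  have hJr : ∀ g ∈ J, inv g ∈ setMul K (W \ K) := fun g hg => (hJR hg).2
  have hsub : s '' J ⊆ s '' (W \ K) := by
    rintro _ ⟨j, hj, rfl⟩
    obtain ⟨k, hk, w, hw, hkw, rfl⟩ := hJs hj
    exact ⟨w, hw, (s_mul hkw).symm⟩
  have hrsub : r '' J ⊆ s '' (W \ K) := by
    rintro _ ⟨j, hj, rfl⟩
    obtain ⟨k, hk, w, hw, hkw, h⟩ := hJr j hj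
    exact ⟨w, hw, by rw [← s_mul hkw, h, s_inv]⟩
  -- The sources of the arrows of `W` in a double coset.
  set S : G → Set (UnitSpace G) := fun g => s '' (W ∩ {w | DoubleCosetRel K g w}) with hS
  have hSfin : ∀ g, (S g).Finite := fun g =>
    ((hK.finite_rel g).subset Set.inter_subset_right).image _
  have hScard : ∀ g, (S g).ncard = cosetCount K W g := fun g =>
    (hW.isGSet.2.mono Set.inter_subset_left).ncard_image
  have hmem : ∀ v ∈ setMul K (W \ K), ∀ g, s v ∈ S g ↔ DoubleCosetRel K g v := by
    rintro _ ⟨k, hk, w, hw, hkw, rfl⟩ g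
    rw [s_mul hkw, ← hK.rel_congr (hK.rel_mul_left hk hkw)]
    constructor
    · rintro ⟨w', ⟨hw', hg⟩, he⟩
      obtain rfl := hW.isGSet.eq_of_s hw' hw.1 he
      exact hg
    · exact fun hg => ⟨w, ⟨hw.1, hg⟩, rfl⟩
  have hcard : ∀ g, (s '' J ∩ S g).ncard = (r '' J ∩ S (inv g)).ncard := by
    intro g
    have h1 : s '' J ∩ S g = s '' (J ∩ {w | DoubleCosetRel K g w}) := by
      ext x
      constructor
      · rintro ⟨⟨j, hj, rfl⟩, hx⟩
        exact ⟨j, ⟨hj, (hmem j (hJs hj) g).1 hx⟩, rfl⟩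
      · rintro ⟨j, ⟨hj, hx⟩, rfl⟩
        exact ⟨⟨j, hj, rfl⟩, (hmem j (hJs hj) g).2 hx⟩
    have h2 : r '' J ∩ S (inv g) = r '' (J ∩ {w | DoubleCosetRel K g w}) := by
      ext x
      constructor
      · rintro ⟨⟨j, hj, rfl⟩, hx⟩
        rw [← s_inv, hmem _ (hJr j hj), hK.rel_inv_iff, inv_inv] at hx
        exact ⟨j, ⟨hj, hx⟩, rfl⟩
      · rintro ⟨j, ⟨hj, hx⟩, rfl⟩
        refine ⟨⟨j, hj, rfl⟩, ?_⟩
        rw [← s_inv, hmem _ (hJr j hj)]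
        exact hK.rel_inv hx
    rw [h1, h2, (hJ.isGSet.1.mono Set.inter_subset_left).ncard_image,
      (hJ.isGSet.2.mono Set.inter_subset_left).ncard_image]
  have hSK : ∀ g ∉ K, S g ⊆ s '' (W \ K) := by
    rintro g hg _ ⟨w, ⟨hw, hgw⟩, rfl⟩
    exact ⟨w, ⟨hw, hK.notMem_of_rel hgw hg⟩, rfl⟩
  have hinvK : ∀ g ∉ K, inv g ∉ K := fun g hg h =>
    hg (by simpa [inv_inv] using hK.inv_mem _ h)
  have hs : s '' J = s '' (W \ K) := by
    refine hsub.antisymm ?_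
    rintro _ ⟨w, hw, rfl⟩
    by_contra hna
    -- Sources of `J` in `S w` and ranges of `J` in `S w⁻¹` are equally many, so the latter are also
    -- incomplete.
    have h1 : (s '' J ∩ S w).ncard < (S w).ncard := by
      refine Set.ncard_lt_ncard ⟨Set.inter_subset_right, fun h => hna ?_⟩ (hSfin w)
      exact (h ⟨w, ⟨hw.1, hK.rel_refl w⟩, rfl⟩).1
    rw [hcard, hScard, hsymm w hw.2, ← hScard] at h1
    obtain ⟨b, hb, hb'⟩ := Set.exists_mem_notMem_of_ncard_lt_ncard h1
      ((hSfin _).subset Set.inter_subset_right)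
    obtain ⟨w₂, ⟨hw₂, hrel⟩, rfl⟩ := id hb
    have hw₂K := hK.notMem_of_rel hrel (hinvK w hw.2)
    obtain ⟨k, hk, k', hk', h2, h3, h4⟩ := hrel
    rw [rng_inv] at h2
    rw [src_inv] at h3
    -- The arrow `k'⁻¹ w` could be added to `J`.
    have h5 : src (inv k') = rng w := by rw [src_inv, h3]
    have h6 : src (inv w) = rng k' := by rw [src_inv, h3]
    have h7 : src k = rng (inv w) := by rw [rng_inv, h2]
    have h8 : src (mul k (inv w)) = rng k' := by rw [src_mul _ _ h7, h6]
    have h9 : r (mul (inv k') w) = s w₂ := by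
      rw [r_mul h5, r_inv, h4, s_mul h8]
    have h10 : inv (mul (inv k') w) = mul (inv k) w₂ := by
      rw [inv_mul_rev h5, inv_inv, h4, GroupoidStr.mul_assoc _ _ _ h7 h6,
        inv_mul_cancel_left (by rw [rng_mul _ _ h6, h7])]
    have h11 : src (inv k) = rng w₂ := by
      rw [src_inv, h4, rng_mul _ _ h8, rng_mul _ _ h7]
    rcases hmax (mul (inv k') w) ⟨⟨inv k', hK.inv_mem _ hk', w, hw, h5, rfl⟩,
      ⟨inv k, hK.inv_mem _ hk, w₂, ⟨hw₂, hw₂K⟩, h11, h10.symm⟩⟩ with h | h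
    · rw [s_mul h5] at h
      exact hna h
    · rw [h9] at h
      exact hb' ⟨h, hb⟩
  refine ⟨J, hJs, hJr, hJ, hs, hrsub.antisymm ?_⟩
  rintro _ ⟨w, hw, rfl⟩
  have h1 := hcard (inv w)
  rw [hs, Set.inter_eq_self_of_subset_right (hSK _ (hinvK w hw.2)), inv_inv, hScard,
    ← hsymm w hw.2, ← hScard] at h1
  have h2 := Set.eq_of_subset_of_ncard_le (Set.inter_subset_right (s := r '' J)) h1.le (hSfin w)
  have h3 : s w ∈ S w := ⟨w, ⟨hw.1, hK.rel_refl w⟩, rfl⟩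
  rw [← h2] at h3
  exact h3.1

/-- A homeomorphism that is symmetric modulo `K` is the product of an element of the full group of
`K` and one whose square lies there. The second factor exchanges matched arrows; it need not be an
involution, as an arrow may be inverse to itself modulo `K`. -/
theorem exists_factorization {W : Set G} {ω : UnitSpace G ≃ₜ UnitSpace G} (hW : IsTau W ω)
    (hsymm : ∀ g ∉ K, cosetCount K W g = cosetCount K W (inv g)) :
    ∃ κ ι : topologicalFullGroup G, ω = κ.1 * ι.1 ∧ IsElementaryHomeo κ.1 ∧
      IsElementaryHomeo (ι.1 ^ 2) := by
  obtain ⟨J, hJs, hJr, hJ, hs, hr⟩ := hK.exists_matching hW.isBisection hsymm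
  obtain ⟨ι, hι⟩ := hJ.isTau_extendByUnits (hr.trans hs.symm)
  refine ⟨⟨ω * ι⁻¹, _, hW.mul hι.inv⟩, ⟨ι, _, hι⟩, by simp, ?_, ?_⟩
  · refine hK.isElementaryHomeo (hW.mul hι.inv) ?_
    rintro _ ⟨w, hw, v, hv, hwv, rfl⟩
    rcases hv with hv | ⟨hv, hvs⟩
    · obtain ⟨k, hk, w', hw', hkw, he⟩ := hJs hv
      have h1 : w' = w := by
        refine hW.isGSet.eq_of_s hw'.1 hw ?_
        rw [← s_mul hkw, he, s_inv]
        exact (s_eq_r_iff.2 hwv).symm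
      subst h1
      have h2 : v = mul (inv w') (inv k) := by rw [← inv_mul_rev hkw, he, inv_inv]
      have h3 : src (inv w') = rng (inv k) := by rw [src_inv, rng_inv, hkw]
      rw [h2, ← GroupoidStr.mul_assoc _ _ _ (rng_inv w').symm h3, GroupoidStr.mul_inv, ← hkw,
        ← rng_inv k, rng_mul_self]
      exact hK.inv_mem _ hk
    · have h1 : w ∈ K := by
        by_contra hwK
        refine hvs ?_
        rw [hs]
        exact ⟨w, ⟨hw, hwK⟩, by rw [s_inv]; exact s_eq_r_iff.2 hwv⟩
      refine hK.mul_mem _ h1 _ ?_ hwv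
      have := hK.inv_mem _ (hK.units_mem _ hv)
      rwa [inv_inv] at this
  · refine hK.isElementaryHomeo (U := setMul (extendByUnits J) (extendByUnits J))
      (by rw [pow_two]; exact hι.mul hι) ?_
    rintro _ ⟨i, hi, j, hj, hij, rfl⟩
    have hij' := s_eq_r_iff.2 hij
    rcases hj with hj | ⟨hj, hjs⟩
    · have hi : i ∈ J := by
        rcases hi with hi | ⟨-, hi⟩
        · exact hi
        · refine (hi ?_).elim
          rw [hij', hs, ← hr]
          exact ⟨j, hj, rfl⟩
      obtain ⟨k, hk, w, hw, hkw, rfl⟩ := hJs hi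
      obtain ⟨k', hk', w', hw', hkw', he⟩ := hJr j hj
      have h1 : w' = w := by
        refine hW.isGSet.eq_of_s hw'.1 hw.1 ?_
        rw [← s_mul hkw', he, s_inv, ← hij', s_mul hkw]
      subst h1
      have h2 : j = mul (inv w') (inv k') := by rw [← inv_mul_rev hkw', he, inv_inv]
      have h3 : src (inv w') = rng (inv k') := by rw [src_inv, rng_inv, hkw']
      have h4 : src (mul k w') = rng (inv w') := by rw [src_mul _ _ hkw, rng_inv]
      rw [h2, ← GroupoidStr.mul_assoc _ _ _ h4 h3, mul_inv_cancel_right hkw]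
      exact hK.mul_mem _ hk _ (hK.inv_mem _ hk') (by rw [rng_inv, hkw, hkw'])
    · have hi : i ∈ K := by
        rcases hi with hi | ⟨hi, -⟩
        · refine (hjs ?_).elim
          have h1 : s j = r j := Subtype.ext ((src_unit hj).trans (hj : rng j = j).symm)
          rw [h1, ← hij']
          exact ⟨i, hi, rfl⟩
        · exact hK.units_mem _ hi
      exact hK.mul_mem _ hi _ (hK.units_mem _ hj) hij

end IsElementarySubgroupoid

end EtaleGpd

/-! ### Elementary homeomorphisms with trivial cube -/

namespace EtaleGpd

open GroupoidStr

section Homeo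

variable {X : Type*} [TopologicalSpace X]

theorem IsElementaryHomeo.inv {γ : X ≃ₜ X} (h : IsElementaryHomeo γ) :
    IsElementaryHomeo γ⁻¹ := by
  refine ⟨h.1.inv, fun k => ?_⟩
  have : {x | (γ⁻¹ ^ k) x = x} = {x | (γ ^ k) x = x} := by
    ext x
    change (γ⁻¹ ^ k) x = x ↔ (γ ^ k) x = x
    rw [inv_pow]
    change (γ ^ k).symm x = x ↔ _
    rw [Homeomorph.symm_apply_eq, eq_comm]
  rw [this]
  exact h.2 k

theorem isElementaryHomeo_one : IsElementaryHomeo (1 : X ≃ₜ X) := by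
  refine ⟨IsOfFinOrder.one, fun k => ?_⟩
  have : {x : X | ((1 : X ≃ₜ X) ^ k) x = x} = Set.univ := by
    rw [one_pow]
    exact Set.eq_univ_of_forall fun _ => rfl
  rw [this]
  exact isClopen_univ

theorem isElementaryHomeo_of_pow_three {γ : X ≃ₜ X} (h : γ ^ 3 = 1)
    (hfix : IsClopen {x | γ x = x}) : IsElementaryHomeo γ := by
  refine ⟨isOfFinOrder_iff_pow_eq_one.2 ⟨3, by norm_num, h⟩, fun k => ?_⟩
  have hk : γ ^ k = γ ^ (k % 3) := by
    conv_lhs => rw [← Nat.div_add_mod k 3, pow_add, pow_mul, h, one_pow, one_mul]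
  rw [hk]
  have hlt : k % 3 < 3 := Nat.mod_lt _ (by norm_num)
  have hcube : ∀ x, γ (γ (γ x)) = x := fun x => by
    have : (γ ^ 3) x = x := by rw [h]; rfl
    exact this
  interval_cases k % 3
  · have : {x : X | (γ ^ 0) x = x} = Set.univ := by
      rw [pow_zero]
      exact Set.eq_univ_of_forall fun _ => rfl
    rw [this]
    exact isClopen_univ
  · rwa [pow_one]
  · have : {x : X | (γ ^ 2) x = x} = {x | γ x = x} := by
      ext x
      change γ (γ x) = x ↔ γ x = x
      constructor
      · intro hx
        have := hcube x
        rwa [hx] at this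
      · intro hx
        rw [hx, hx]
    rwa [this]

end Homeo

variable {G : Type*} [TopologicalSpace G] [GroupoidStr G] [EtaleGroupoid G]

/-- The edges of the triangles in the family `D`, transported by the arrows of `Q`: the edge `j`
of `p ∈ D i` becomes an arrow from the range of the arrow of `Q (i, j)` at its source to the range
of the arrow of `Q (i, j + 1)` at its range. -/
def transportEdges {ι : Type*} (D : ι → Set (ComposablePairs G)) (Q : ι × Fin 3 → Set G)
    (a : ι × Fin 3) : Set G :=
  setMul (setMul (Q (a.1, a.2 + 1)) (edge a.2 '' D a.1)) (inv ⁻¹' Q a)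

/-- The sets `Q (i, j)` carry the vertices of the triangles in `D i` to pairwise disjoint sets. -/
structure IsPlacement {ι : Type*} (D : ι → Set (ComposablePairs G)) (Q : ι × Fin 3 → Set G) :
    Prop where
  isSimplexSet : ∀ i, IsSimplexSet (D i)
  isBisection : ∀ a, IsBisection (Q a)
  image_s : ∀ a, s '' Q a = s '' (edge a.2 '' D a.1)
  disjoint : Pairwise (Function.onFun Disjoint fun a => r '' Q a)

namespace IsPlacement

variable {ι : Type*} {D : ι → Set (ComposablePairs G)} {Q : ι × Fin 3 → Set G}
  (h : IsPlacement D Q)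
include h

theorem image_r_edge (i : ι) (j : Fin 3) : r '' (edge j '' D i) = s '' Q (i, j + 1) := by
  rw [h.image_s, Set.image_image, Set.image_image]
  exact Set.image_congr fun p _ => (s_eq_r_iff.2 (src_edge_succ j p)).symm

theorem isBisection_transportEdges (a : ι × Fin 3) : IsBisection (transportEdges D Q a) :=
  ((h.isBisection _).setMul ((h.isSimplexSet _).isBisection_image _)).setMul (h.isBisection _).inv

theorem image_s_left (a : ι × Fin 3) :
    s '' setMul (Q (a.1, a.2 + 1)) (edge a.2 '' D a.1) = s '' Q a := by
  rw [image_s_setMul (h.image_r_edge _ _).subset, h.image_s a]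

theorem image_s_transportEdges (a : ι × Fin 3) : s '' transportEdges D Q a = r '' Q a := by
  rw [transportEdges, image_s_setMul, image_s_inv]
  rw [image_r_inv, h.image_s_left]

theorem image_r_transportEdges (a : ι × Fin 3) :
    r '' transportEdges D Q a = r '' Q (a.1, a.2 + 1) := by
  rw [transportEdges, image_r_setMul, image_r_setMul (h.image_r_edge _ _).superset]
  rw [image_r_inv, h.image_s_left]

theorem isBisection_iUnion [Finite ι] : IsBisection (⋃ a, transportEdges D Q a) := by
  refine IsBisection.iUnion h.isBisection_transportEdges ?_ ?_
  · intro a b hab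
    rw [Function.onFun, h.image_s_transportEdges, h.image_s_transportEdges]
    exact h.disjoint hab
  · intro a b hab
    rw [Function.onFun, h.image_r_transportEdges, h.image_r_transportEdges]
    refine h.disjoint fun hab' => hab ?_
    rw [Prod.mk.injEq] at hab'
    exact Prod.ext hab'.1 (add_right_cancel hab'.2)

theorem image_s_iUnion : s '' (⋃ a, transportEdges D Q a) = ⋃ a, r '' Q a := by
  rw [Set.image_iUnion]
  exact Set.iUnion_congr h.image_s_transportEdges

theorem image_r_iUnion : r '' (⋃ a, transportEdges D Q a) = ⋃ a, r '' Q a := by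
  rw [Set.image_iUnion, Set.iUnion_congr h.image_r_transportEdges]
  ext x
  simp only [Set.mem_iUnion]
  constructor
  · rintro ⟨a, ha⟩
    exact ⟨_, ha⟩
  · rintro ⟨a, ha⟩
    exact ⟨(a.1, a.2 - 1), by rwa [sub_add_cancel]⟩

theorem cosetCount_iUnion [CompactSpace (UnitSpace G)] [TotallyDisconnectedSpace (UnitSpace G)]
    [Fintype ι] {K : Set G} (hK : IsElementarySubgroupoid K) (hQK : ∀ a, Q a ⊆ K) (g : G) :
    cosetCount K (⋃ a, transportEdges D Q a) g =
      ∑ i, ∑ j, cosetCount K (edge j '' D i) g := by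
  have hd : Pairwise (Function.onFun Disjoint (transportEdges D Q)) := by
    intro a b hab
    refine Set.disjoint_left.2 fun t ha hb => ?_
    have h1 := Set.mem_image_of_mem s ha
    have h2 := Set.mem_image_of_mem s hb
    rw [h.image_s_transportEdges] at h1 h2
    exact Set.disjoint_left.1 (h.disjoint hab) h1 h2
  have h1 := hK.cosetCount_biUnion Finset.univ (transportEdges D Q) hd g
  simp only [Finset.mem_univ, Set.iUnion_true] at h1
  rw [h1, Fintype.sum_prod_type]
  refine Finset.sum_congr rfl fun i _ => Finset.sum_congr rfl fun j _ => ?_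
  have hb := (h.isSimplexSet i).isBisection_image j
  have hinv : inv ⁻¹' Q (i, j) ⊆ K := fun k hk => by
    have := hK.inv_mem _ (hQK _ hk)
    rwa [inv_inv] at this
  rw [transportEdges, hK.cosetCount_setMul_right hinv (h.isBisection _).isGSet.inv
    ((h.isBisection _).isGSet.setMul hb.isGSet), hK.cosetCount_setMul_left (hQK _)
    (h.isBisection _).isGSet hb.isGSet (h.image_r_edge i j).subset]
  rw [image_r_inv]
  exact (h.image_s_left (i, j)).subset

/-- The placed triangles define an element of order dividing three in the full group, which
permutes cyclically the three vertices of each triangle. -/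
theorem exists_isTau [CompactSpace (UnitSpace G)] [Finite ι] :
    ∃ τ : UnitSpace G ≃ₜ UnitSpace G,
      IsTau (extendByUnits (⋃ a, transportEdges D Q a)) τ ∧ IsElementaryHomeo τ := by
  obtain ⟨τ, hτ⟩ := h.isBisection_iUnion.isTau_extendByUnits
    (h.image_r_iUnion.trans h.image_s_iUnion.symm)
  have hout : ∀ x, (x ∉ ⋃ a, r '' Q a) → τ x = x := by
    intro x hx
    rw [← h.image_s_iUnion] at hx
    have := hτ.apply_s x.1 (Or.inr ⟨x.2, by rwa [s_val]⟩)
    rwa [s_val, r_val] at this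
  have hmove : ∀ i j, ∀ p ∈ D i, ∀ q ∈ Q (i, j), ∀ q' ∈ Q (i, j + 1), s q = s (edge j p) →
      s q' = s (edge (j + 1) p) → τ (r q) = r q' := by
    intro i j p hp q hq q' hq' h1 h2
    have h3 : src q' = rng (edge j p) := (s_eq_s_iff.1 h2).trans (src_edge_succ j p)
    have h4 : src (mul q' (edge j p)) = rng (inv q) := by
      rw [src_mul _ _ h3, rng_inv]
      exact (s_eq_s_iff.1 h1).symm
    have := hτ.apply_s (mul (mul q' (edge j p)) (inv q)) (Or.inl (Set.mem_iUnion.2 ⟨(i, j),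
      _, ⟨q', hq', _, ⟨p, hp, rfl⟩, h3, rfl⟩, inv q, by simpa [inv_inv] using hq, h4, rfl⟩))
    rwa [s_mul h4, s_inv, r_mul h4, r_mul h3] at this
  have hex : ∀ i j, ∀ p ∈ D i, ∃ q ∈ Q (i, j), s q = s (edge j p) := by
    intro i j p hp
    have : s (edge j p) ∈ s '' Q (i, j) := by
      rw [h.image_s]
      exact ⟨_, ⟨p, hp, rfl⟩, rfl⟩
    exact this
  have hP : ∀ x ∈ ⋃ a, r '' Q a, ∃ i j, ∃ p ∈ D i, ∃ q ∈ Q (i, j), s q = s (edge j p) ∧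
      x = r q := by
    intro x hx
    obtain ⟨⟨i, j⟩, q, hq, rfl⟩ := Set.mem_iUnion.1 hx
    have : s q ∈ s '' Q (i, j) := ⟨q, hq, rfl⟩
    rw [h.image_s] at this
    obtain ⟨_, ⟨p, hp, rfl⟩, he⟩ := this
    exact ⟨i, j, p, hp, q, hq, he.symm, rfl⟩
  have hfix : {x | τ x = x} = (⋃ a, r '' Q a)ᶜ := by
    ext x
    constructor
    · intro hx hxP
      obtain ⟨i, j, p, hp, q, hq, hqp, rfl⟩ := hP x hxP
      obtain ⟨q', hq', hqp'⟩ := hex i (j + 1) p hp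
      have h1 := hmove i j p hp q hq q' hq' hqp hqp'
      have h2 : r q' = r q := h1.symm.trans hx
      have hne : ((i, j + 1) : ι × Fin 3) ≠ (i, j) := by
        rw [ne_eq, Prod.mk.injEq, not_and]
        intro _ hj
        fin_cases j <;> simp at hj
      exact Set.disjoint_left.1 (h.disjoint hne) ⟨q', hq', rfl⟩ ⟨q, hq, h2.symm⟩
    · exact hout x
  have hclopen : IsClopen (⋃ a, r '' Q a) := by
    rw [← h.image_s_iUnion]
    exact isClopen_image_s h.isBisection_iUnion.isCompact h.isBisection_iUnion.isOpen
  refine ⟨τ, hτ, isElementaryHomeo_of_pow_three ?_ (hfix ▸ hclopen.compl)⟩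
  ext1 x
  change τ (τ (τ x)) = x
  by_cases hx : x ∈ ⋃ a, r '' Q a
  · obtain ⟨i, j, p, hp, q, hq, hqp, rfl⟩ := hP x hx
    obtain ⟨q₁, hq₁, hqp₁⟩ := hex i (j + 1) p hp
    obtain ⟨q₂, hq₂, hqp₂⟩ := hex i (j + 1 + 1) p hp
    have hj : j + 1 + 1 + 1 = j := by fin_cases j <;> rfl
    rw [hmove i j p hp q hq q₁ hq₁ hqp hqp₁, hmove i (j + 1) p hp q₁ hq₁ q₂ hq₂ hqp₁ hqp₂]
    exact hmove i (j + 1 + 1) p hp q₂ hq₂ q (hj.symm ▸ hq) hqp₂ (hj.symm ▸ hqp)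
  · rw [hout x hx, hout x hx, hout x hx]

end IsPlacement

namespace IsElementarySubgroupoid

variable [CompactSpace (UnitSpace G)] [TotallyDisconnectedSpace (UnitSpace G)]
  {K : Set G} (hK : IsElementarySubgroupoid K)
include hK

/-- If every arrow of `U` that starts in `r(T)` lies in `K`, then `U` composed with the extension
of `T` by units has, outside `K`, the double cosets of `U` together with those of `T`. -/
theorem cosetCount_setMul_extendByUnits {U T : Set G} {γ : UnitSpace G ≃ₜ UnitSpace G}
    (hU : IsTau U γ) (hT : IsGSet T) (hsr : r '' T = s '' T) (hTU : s '' T ⊆ s '' (U ∩ K))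
    {g : G} (hg : g ∉ K) :
    cosetCount K (setMul U (extendByUnits T)) g = cosetCount K U g + cosetCount K T g := by
  have hUK : ∀ u ∈ U, s u ∈ s '' T → u ∈ K := by
    intro u hu hs
    obtain ⟨u', hu', he⟩ := hTU hs
    obtain rfl := hU.isGSet.eq_of_s hu'.1 hu he
    exact hu'.2
  have h1 : cosetCount K (setMul (U ∩ K) T) g = cosetCount K T g :=
    hK.cosetCount_setMul_left Set.inter_subset_right (hU.isGSet.mono Set.inter_subset_left) hT
      (hsr.trans_subset hTU) g
  have h2 : setMul U (extendByUnits T) ∩ {w | DoubleCosetRel K g w} =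
      (U ∩ {w | DoubleCosetRel K g w}) ∪ (setMul (U ∩ K) T ∩ {w | DoubleCosetRel K g w}) := by
    ext w
    constructor
    · rintro ⟨⟨u, hu, t, ht | ⟨ht, hts⟩, hut, rfl⟩, hw⟩
      · refine Or.inr ⟨⟨u, ⟨hu, hUK u hu ?_⟩, t, ht, hut, rfl⟩, hw⟩
        rw [s_eq_r_iff.2 hut, ← hsr]
        exact ⟨t, ht, rfl⟩
      · have : mul u t = u := by
          rw [← (ht : rng t = t), ← hut, mul_src_self]
        rw [this] at hw ⊢
        exact Or.inl ⟨hu, hw⟩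
    · rintro (⟨hu, hw⟩ | ⟨⟨u, hu, t, ht, hut, rfl⟩, hw⟩)
      · refine ⟨⟨w, hu, src w, Or.inr ⟨rng_src w, fun hs => ?_⟩, (rng_src w).symm,
          mul_src_self w⟩, hw⟩
        have h3 : s (src w) = s w := Subtype.ext (src_src w)
        rw [h3] at hs
        exact hK.notMem_of_rel hw hg (hUK w hu hs)
      · exact ⟨⟨u, hu.1, t, Or.inl ht, hut, rfl⟩, hw⟩
  rw [← h1, cosetCount, h2]
  refine Set.ncard_union_eq ?_ ((hK.finite_rel g).subset Set.inter_subset_right)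
    ((hK.finite_rel g).subset Set.inter_subset_right)
  refine Set.disjoint_left.2 ?_
  rintro w ⟨hu, hw⟩ ⟨⟨u, hu', t, ht, hut, rfl⟩, -⟩
  refine hK.notMem_of_rel hw hg (hUK _ hu ?_)
  rw [s_mul hut]
  exact ⟨t, ht, rfl⟩

end IsElementarySubgroupoid

end EtaleGpd

/-! ### The factorization -/

namespace EtaleGpd

open GroupoidStr

variable {G : Type*} [TopologicalSpace G] [GroupoidStr G] [EtaleGroupoid G]
  [CompactSpace (UnitSpace G)] [TotallyDisconnectedSpace (UnitSpace G)]

/-- The arrows of `C` outside `K` that start in the orbit `K(x)` are no more than `|CKx \ Kx|`: the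
products `ck` with `c` such an arrow are distinct and lie outside `K`. -/
theorem IsElementarySubgroupoid.ncard_image_s_inter_orbit_le {K : Set G}
    (hK : IsElementarySubgroupoid K) {C S : Set G} (hCc : IsCompact C) (hCo : IsOpen C)
    (hS : IsGSet S) (hSC : S ⊆ C) (hSK : ∀ g ∈ S, g ∉ K) (x : UnitSpace G) :
    (s '' S ∩ orbit K x).ncard ≤ (setMul C (sourceFiber K x) \ sourceFiber K x).ncard := by
  have hfin : (setMul C (sourceFiber K x)).Finite := by
    refine ((finite_sourceFiber hK.isCompact hK.isOpen x).biUnion fun k _ =>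
      (finite_sourceFiber hCc hCo (r k)).image fun c => mul c k).subset ?_
    rintro _ ⟨c, hc, k, hk, hck, rfl⟩
    exact Set.mem_biUnion hk ⟨c, ⟨hc, s_eq_r_iff.2 hck⟩, rfl⟩
  have hsub : r '' (S ∩ s ⁻¹' orbit K x) ⊆
      r '' (setMul C (sourceFiber K x) \ sourceFiber K x) := by
    rintro _ ⟨c, ⟨hc, k, hk, hkc⟩, rfl⟩
    have hck := s_eq_r_iff.1 hkc.symm
    refine ⟨mul c k, ⟨⟨c, hSC hc, k, hk, hck, rfl⟩, fun h => hSK c hc ?_⟩, r_mul hck⟩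
    have := hK.mul_mem _ h.1 _ (hK.inv_mem _ hk.1) (by rw [src_mul _ _ hck, rng_inv])
    rwa [mul_inv_cancel_right hck] at this
  rw [← Set.image_inter_preimage, (hS.2.mono Set.inter_subset_left).ncard_image,
    ← (hS.1.mono Set.inter_subset_left).ncard_image]
  exact (Set.ncard_le_ncard hsub (hfin.sdiff.image _)).trans (Set.ncard_image_le hfin.sdiff)

/-- Vanishing of the index, antisymmetrized: `1_U` is, up to functions invariant under inversion,
minus a sum of boundaries of triangles. -/
theorem exists_antisymm_add_sum_eq_zero (hG : IsEssentiallyPrincipal G)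
    (γ : topologicalFullGroup G) (hγ : indexMap γ = 0) {U : Set G}
    (hU : IsTau U (γ : UnitSpace G ≃ₜ UnitSpace G)) :
    ∃ (ι : Type) (_ : Fintype ι) (E : ι → Set (ComposablePairs G)),
      (∀ i, IsSimplexSet (E i)) ∧ ∀ g, antisymm (U.indicator 1) g +
        ∑ i, ∑ j, antisymm ((edge j '' E i).indicator 1) g = 0 := by
  rw [indexMap_eq hG γ hU, IsTau.toH₁, QuotientAddGroup.eq_zero_iff,
    AddSubgroup.mem_addSubgroupOf] at hγ
  obtain ⟨f, hf⟩ := hγ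
  have hf : boundary₂ G f = charFn U hU.isCompact hU.isOpen := hf
  -- The sign is chosen so that the triangles cancel `1_U`.
  obtain ⟨ι, hι, E, hE, h⟩ := exists_antisymm_boundary₂_eq_sum (-f)
  refine ⟨ι, hι, E, hE, fun g => ?_⟩
  rw [← h, map_neg, hf]
  have h1 : ∀ g, charFn U hU.isCompact hU.isOpen g = U.indicator 1 g := fun _ => rfl
  simp only [antisymm, CompactlySupportedContinuousMap.neg_apply, h1]
  ring

/-- For a sufficiently invariant elementary subgroupoid `K` there is room in `s(U ∩ K)` for the
vertices of all triangles without edges in `K`. -/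
theorem exists_isPlacement (hAF : IsAlmostFinite G) {U : Set G}
    {γ : UnitSpace G ≃ₜ UnitSpace G} (hU : IsTau U γ) {ι : Type} [Fintype ι]
    {E : ι → Set (ComposablePairs G)} (hE : ∀ i, IsSimplexSet (E i)) :
    ∃ K, IsElementarySubgroupoid K ∧ ∃ Q : ι × Fin 3 → Set G, (∀ a, Q a ⊆ K) ∧
      (∀ a, r '' Q a ⊆ s '' (U ∩ K)) ∧
      IsPlacement (fun i => E i ∩ {p | ∀ j, edge j p ∉ K}) Q := by
  set C : Set G := U ∪ ⋃ a : ι × Fin 3, edge a.2 '' E a.1 with hC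
  have hEb : ∀ a : ι × Fin 3, IsBisection (edge a.2 '' E a.1) := fun a =>
    (hE a.1).isBisection_image a.2
  have hCc : IsCompact C := hU.isCompact.union (isCompact_iUnion fun a => (hEb a).isCompact)
  have hCo : IsOpen C := hU.isOpen.union (isOpen_iUnion fun a => (hEb a).isOpen)
  set n := Fintype.card (ι × Fin 3) with hn
  -- One share of an orbit for each of the `n` vertices and one for the arrows of `U` outside `K`.
  obtain ⟨K, hK, hinv⟩ := hAF C hCc (1 / (n + 1)) (by positivity)
  have hD : ∀ i, IsSimplexSet (E i ∩ {p | ∀ j, edge j p ∉ K}) := fun i =>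
    (hE i).inter hK.isClopen_edges_notMem
  have hDb : ∀ a : ι × Fin 3, IsBisection (edge a.2 '' (E a.1 ∩ {p | ∀ j, edge j p ∉ K})) :=
    fun a => (hD a.1).isBisection_image a.2
  have hUK := hU.isBisection.inter hK.isClopen
  obtain ⟨Q, hQ, hQd⟩ := hK.exists_isBisection_family Finset.univ
    (fun a : ι × Fin 3 => s '' (edge a.2 '' (E a.1 ∩ {p | ∀ j, edge j p ∉ K})))
    (fun a => isClopen_image_s (hDb a).isCompact (hDb a).isOpen)
    (isClopen_image_s hUK.isCompact hUK.isOpen) fun x => by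
      set m := (setMul C (sourceFiber K x) \ sourceFiber K x).ncard with hm
      have hfin := hK.finite_orbit x
      have hpos : 0 < (orbit K x).ncard :=
        (Set.ncard_pos hfin).2 ⟨x, hK.mem_orbit_self x⟩
      have h1 : m * (n + 1) < (orbit K x).ncard := by
        have := hinv x
        rw [div_lt_div_iff₀ (by exact_mod_cast hpos) (by positivity), one_mul] at this
        exact_mod_cast this
      have h2 : ∑ a : ι × Fin 3,
          (s '' (edge a.2 '' (E a.1 ∩ {p | ∀ j, edge j p ∉ K})) ∩ orbit K x).ncard ≤ n * m := by
        rw [hn, ← smul_eq_mul, ← Finset.card_univ]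
        refine Finset.sum_le_card_nsmul _ _ _ fun a _ =>
          hK.ncard_image_s_inter_orbit_le hCc hCo (hDb a).isGSet ?_ ?_ x
        · exact (Set.image_mono Set.inter_subset_left).trans
            ((Set.subset_iUnion (fun a : ι × Fin 3 => edge a.2 '' E a.1) a).trans
              Set.subset_union_right)
        · rintro _ ⟨p, hp, rfl⟩
          exact hp.2 a.2
      have h3 : (s '' (U \ K) ∩ orbit K x).ncard ≤ m :=
        hK.ncard_image_s_inter_orbit_le hCc hCo (hU.isGSet.mono Set.sdiff_subset)
          (Set.sdiff_subset.trans Set.subset_union_left) (fun g hg => hg.2) x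
      have h4 : orbit K x = (s '' (U ∩ K) ∩ orbit K x) ∪ (s '' (U \ K) ∩ orbit K x) := by
        rw [← Set.union_inter_distrib_right, ← Set.image_union, Set.inter_union_sdiff,
          hU.image_s, Set.univ_inter]
      have h5 := Set.ncard_union_le (s '' (U ∩ K) ∩ orbit K x) (s '' (U \ K) ∩ orbit K x)
      rw [← h4] at h5
      nlinarith
  have hQ := fun a => hQ a (Finset.mem_univ a)
  exact ⟨K, hK, Q, fun a => (hQ a).1, fun a => (hQ a).2.2.2, hD, fun a => (hQ a).2.1,
    fun a => (hQ a).2.2.1, fun a b hab => hQd (Finset.mem_coe.2 (Finset.mem_univ a))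
      (Finset.mem_coe.2 (Finset.mem_univ b)) hab⟩

/-- Composing `γ` with the permutation with trivial cube given by the triangles makes it symmetric
modulo `K`. -/
theorem exists_elementary_factorization (hG : IsEssentiallyPrincipal G) (hAF : IsAlmostFinite G)
    (γ : topologicalFullGroup G) (hγ : indexMap γ = 0) :
    ∃ γ₁ γ₂ γ₃ : topologicalFullGroup G, γ = γ₁ * γ₂ * γ₃ ∧ IsElementaryHomeo γ₁.1 ∧
      IsElementaryHomeo (γ₂.1 ^ 2) ∧ IsElementaryHomeo γ₃.1 := by
  obtain ⟨U, hU⟩ := γ.2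
  obtain ⟨ι, _, E, hE, hsum⟩ := exists_antisymm_add_sum_eq_zero hG γ hγ hU
  obtain ⟨K, hK, Q, hQK, hQU, hQ⟩ := exists_isPlacement hAF hU hE
  obtain ⟨τ, hτ, hτe⟩ := hQ.exists_isTau
  have hsym : ∀ g ∉ K,
      cosetCount K (setMul U (extendByUnits (⋃ a, transportEdges
        (fun i => E i ∩ {p | ∀ j, edge j p ∉ K}) Q a))) g =
      cosetCount K (setMul U (extendByUnits (⋃ a, transportEdges
        (fun i => E i ∩ {p | ∀ j, edge j p ∉ K}) Q a))) (inv g) := by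
    intro g hg
    have hg' : inv g ∉ K := fun h => hg (by simpa [inv_inv] using hK.inv_mem _ h)
    have hsr := hQ.image_r_iUnion.trans hQ.image_s_iUnion.symm
    have hTU := hQ.image_s_iUnion.trans_subset (Set.iUnion_subset hQU)
    have hTb := hQ.isBisection_iUnion.isGSet
    rw [hK.cosetCount_setMul_extendByUnits hU hTb hsr hTU hg,
      hK.cosetCount_setMul_extendByUnits hU hTb hsr hTU hg', hQ.cosetCount_iUnion hK hQK,
      hQ.cosetCount_iUnion hK hQK]
    have h1 : ∑ w ∈ (hK.finite_rel g).toFinset, (antisymm (U.indicator 1) w +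
        ∑ i, ∑ j, antisymm ((edge j '' E i).indicator 1) w) = 0 :=
      Finset.sum_eq_zero fun w _ => hsum w
    rw [Finset.sum_add_distrib, Finset.sum_comm, hK.sum_antisymm_indicator_coset] at h1
    have h2 : ∀ i, ∑ w ∈ (hK.finite_rel g).toFinset,
        ∑ j, antisymm ((edge j '' E i).indicator 1) w =
        ∑ j, ((cosetCount K (edge j '' (E i ∩ {p | ∀ j, edge j p ∉ K})) g : ℤ) -
          cosetCount K (edge j '' (E i ∩ {p | ∀ j, edge j p ∉ K})) (inv g)) := by
      intro i
      rw [Finset.sum_comm, ← hK.sum_cosetCount_edge (hE i) hg]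
      exact Finset.sum_congr rfl fun j _ => hK.sum_antisymm_indicator_coset _ _
    rw [Finset.sum_congr rfl fun i _ => h2 i] at h1
    simp only [Finset.sum_sub_distrib] at h1
    zify
    linarith
  obtain ⟨κ, σ, hω, hκ, hσ⟩ := hK.exists_factorization (hU.mul hτ) hsym
  refine ⟨κ, σ, ⟨τ⁻¹, _, hτ.inv⟩, Subtype.ext ?_, hκ, hσ, hτe.inv⟩
  change γ.1 = κ.1 * σ.1 * τ⁻¹
  rw [← hω, _root_.mul_inv_cancel_right]

end EtaleGpd

theorem theorem7p11 {G : Type*} [TopologicalSpace G] [EtaleGpd.GroupoidStr G]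
    [EtaleGpd.EtaleGroupoid G] [SecondCountableTopology G]
    [CompactSpace (EtaleGpd.UnitSpace G)] [TotallyDisconnectedSpace (EtaleGpd.UnitSpace G)]
    (hG : EtaleGpd.IsEssentiallyPrincipal G) (hAF : EtaleGpd.IsAlmostFinite G)
    (γ : EtaleGpd.topologicalFullGroup G) (hγ : EtaleGpd.indexMap γ = 0) :
    (∃ γ₁ γ₂ γ₃ γ₄ : EtaleGpd.topologicalFullGroup G,
      γ = γ₁ * γ₂ * γ₃ * γ₄ ∧
      EtaleGpd.IsElementaryHomeo γ₁.1 ∧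
      EtaleGpd.IsElementaryHomeo (γ₂.1 ^ 2) ∧
      EtaleGpd.IsElementaryHomeo γ₃.1 ∧
      EtaleGpd.IsElementaryHomeo γ₄.1) ∧
    (∃ δ₁ δ₂ δ₃ δ₄ : EtaleGpd.topologicalFullGroup G,
      γ = δ₁ * δ₂ * δ₃ * δ₄ ∧
      IsOfFinOrder δ₁ ∧ IsOfFinOrder δ₂ ∧ IsOfFinOrder δ₃ ∧ IsOfFinOrder δ₄) := by
  obtain ⟨γ₁, γ₂, γ₃, h, h₁, h₂, h₃⟩ :=
    EtaleGpd.exists_elementary_factorization hG hAF γ hγ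
  have h' : γ = γ₁ * γ₂ * γ₃ * 1 := by rw [mul_one, h]
  refine ⟨⟨γ₁, γ₂, γ₃, 1, h', h₁, h₂, h₃, EtaleGpd.isElementaryHomeo_one⟩,
    γ₁, γ₂, γ₃, 1, h', Submonoid.isOfFinOrder_coe.1 h₁.1, ?_, Submonoid.isOfFinOrder_coe.1 h₃.1,
    IsOfFinOrder.one⟩
  exact Submonoid.isOfFinOrder_coe.1 (IsOfFinOrder.of_pow h₂.1 two_ne_zero)
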